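/- Let $\Pi$ be a set of prime numbers and let $\mathcal C$ be the class of all finite $\Pi$-groups (finite groups whose order is a product of primes in $\Pi$). A pro-$\mathcal C$ group is a profinite group all of whose quotients by open normal subgroups lie in $\mathcal C$. Put $\hat{\mathbb Z}_{\mathcal C}=\prod_{p\in\Pi}\mathbb Z_p$. Let $A$ be any (possibly infinite) set and let $S=S_A(\mathcal C)$ be the free pro-$\mathcal C$ group on basis $A$ with respect to $\iota:A\to S$; that is, $S$ is pro-$\mathcal C$, $\iota$ converges to $1$ (every open normal subgroup contains $\iota(a)$ for all but finitely many $a\in A$), $\iota(A)$ topologically generates $S$, and every map converging to $1$ from $A$ to a pro-$\mathcal C$ group $G$ extends uniquely to a continuous homomorphism $S\to G$. For a commutative unital ring $R_0$, the Magnus algebra $R_0\langle\langle X_A\rangle\rangle$ is the ring of formal power series $\sum_I c_IX_I$ over $R_0$ in non-commuting variables $X_a$ ($a\in A$), where $I$ ranges over the finite sequences of elements of $A$; when $R_0$ is a topological ring it carries the product topology. Let $V_{R_0,A,1}$ be the multiplicative group of power series with constant term $1$. For topological groups $H,G$ let $\mathrm{KerInt}_{\mathrm{cont}}(H,G)$ be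 the intersection of the kernels of all continuous homomorphisms $H\to G$. Let $\mathbb U_n(R)$ be the group of upper-triangular unipotent $n\times n$ matrices over $R$. Let $S^{(1)}=S$, and let $S^{(i)}$ be the closed subgroup generated by $[S,S^{(i-1)}]$ for $i\ge 2$. Then there is a unique continuous homomorphism (the Magnus homomorphism) $\Lambda:S\to V_{\hat{\mathbb Z}_{\mathcal C},A,1}$ with $\Lambda(\iota(a))=1+X_a$ for all $a\in A$, and the following hold for every integer $n\ge1$. **(1)** Let $R$ be a commutative profinite ring whose additive group is pro-$\mathcal C$, let $\theta:\hat{\mathbb Z}_{\mathcal C}\to R$ be a continuous unital ring homomorphism, let $d\in R$, and put $J_t=d^tR$ for $0\le t\le n-1$. For $t\ge0$ let $T_{n,t}(\mathcal J)$ be the set of $n\times n$ matrices $(a_{ij})$ over $R$ with $a_{ij}=0$ whenever $j-i\le t-1$ and $a_{ij}\in J_{j-i}$ whenever $i\le j$, and let $\mathbb U_n(\mathcal J)=T_{n,0}(\mathcal J)\cap\mathbb U_n(R)$. Let $L_{\mathcal J}$ be the set of all $\sum_Ic_IX_I\in\hat{\mathbb Z}_{\mathcal C}\langle\langle X_A\rangle\rangle$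 with $c_\emptyset=1$ and $\theta(c_I)\in\mathrm{Ann}_R(J_t)$ for every sequence $I$ of length $1\le t<n$. Then: (a) $\mathbb U_n(\mathcal J)$ is a pro-$\mathcal C$ group, the ideals $\mathrm{Ann}_R(J_t)$ are closed in $R$, and $L_{\mathcal J}$ is closed in $\hat{\mathbb Z}_{\mathcal C}\langle\langle X_A\rangle\rangle$. (b) For every continuous homomorphism $\varphi:S\to\mathbb U_n(\mathcal J)$ put $M_I=\prod_{k=1}^t(\varphi(\iota(a_k))-1)$ for $I=(a_1,\dots,a_t)$. Then $M_I\in T_{n,t}(\mathcal J)$, and there is a continuous unital ring homomorphism $\hat\varphi:\hat{\mathbb Z}_{\mathcal C}\langle\langle X_A\rangle\rangle\to T_{n,0}(\mathcal J)$ given by the (convergent) sums $\hat\varphi(\sum_Ic_IX_I)=\sum_{|I|<n}\theta(c_I)M_I$. It satisfies $\hat\varphi(c)=\theta(c)\cdot 1$ for $c\in\hat{\mathbb Z}_{\mathcal C}$ and $\hat\varphi\circ\Lambda=\varphi$ on $S$, and it is the unique continuous ring homomorphism with these two properties. (c) $\Lambda^{-1}(L_{\mathcal J})=\mathrm{KerInt}_{\mathrm{cont}}(S,\mathbb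 U_n(\mathcal J))$. **(2)** $S^{(n)}=\mathrm{KerInt}_{\mathrm{cont}}(S,\mathbb U_n(\hat{\mathbb Z}_{\mathcal C}))$. (When $\Pi$ is the set of all primes, this is the case of a free profinite group $S$ and $\hat{\mathbb Z}_{\mathcal C}=\hat{\mathbb Z}$.) If $\Pi=\{p\}$, so that $S$ is a free pro-$p$ group, then $S^{(n)}=\mathrm{KerInt}_{\mathrm{cont}}(S,\mathbb U_n(\mathbb Z_p))$. -/

import Mathlib

open scoped Topology

/-! ## Pro-`C` groups, where `C` is the class of finite `Π`-groups -/

/-- A finite `Π`-group: a finite group whose order is a product of primes in `Π`. -/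
def IsFinitePiGroup (P : Set Nat.Primes) (G : Type*) [Group G] : Prop :=
  Finite G ∧ ∀ p : Nat.Primes, (p : ℕ) ∣ Nat.card G → p ∈ P

/-- A pro-`C(Π)` group: a profinite group all of whose quotients by open normal subgroups are
finite `Π`-groups. -/
structure IsProPi (P : Set Nat.Primes) (G : Type*) [Group G] [TopologicalSpace G]
    [IsTopologicalGroup G] : Prop where
  compact : CompactSpace G
  t2 : T2Space G
  totallyDisconnected : TotallyDisconnectedSpace G
  quotient : ∀ (N : Subgroup G) [N.Normal], IsOpen (N : Set G) → IsFinitePiGroup P (G ⧸ N)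

/-- A map `φ : A → G` converges to `1` if for every open normal subgroup `N` of `G` all but
finitely many elements of `A` are mapped into `N`. -/
def ConvergesToOne {A G : Type*} [Group G] [TopologicalSpace G] (φ : A → G) : Prop :=
  ∀ N : Subgroup G, N.Normal → IsOpen (N : Set G) → {a : A | φ a ∉ N}.Finite

/-- `S` is a free pro-`C(Π)` group on the basis `A` with respect to `ι : A → S`.
The universe `w` of the test groups `G` is a parameter; it is immaterial, since every pro-`C(Π)`
group is an inverse limit of finite groups. -/
structure IsFreeProPi.{w, u, v} (P : Set Nat.Primes) {A : Type u} {S : Type v} [Group S]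
    [TopologicalSpace S] [IsTopologicalGroup S] (ι : A → S) : Prop where
  isProPi : IsProPi P S
  converges : ConvergesToOne ι
  generates : (Subgroup.closure (Set.range ι)).topologicalClosure = ⊤
  lift : ∀ (G : Type w) [Group G] [TopologicalSpace G] [IsTopologicalGroup G], IsProPi P G →
    ∀ φ : A → G, ConvergesToOne φ → ∃! ψ : S →ₜ* G, ∀ a, ψ (ι a) = φ a

/-- The closed lower central filtration: `S⁽¹⁾ = S`, and `S⁽ⁱ⁾` is the closed subgroup generated
by `[S, S⁽ⁱ⁻¹⁾]` for `i ≥ 2`.  (The value at `0` is not used.) -/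
def closedLowerCentral (S : Type*) [Group S] [TopologicalSpace S] [IsTopologicalGroup S] :
    ℕ → Subgroup S
  | 0 => ⊤
  | 1 => ⊤
  | n + 2 => ⁅(⊤ : Subgroup S), closedLowerCentral S (n + 1)⁆.topologicalClosure

/-- The intersection of the kernels of all continuous homomorphisms `H → G`. -/
def kerIntCont (H G : Type*) [Group H] [TopologicalSpace H] [Group G] [TopologicalSpace G] :
    Subgroup H :=
  ⨅ φ : H →ₜ* G, (φ : H →* G).ker

instance factPrimeOfPrimes (p : Nat.Primes) : Fact (Nat.Prime (p : ℕ)) := ⟨p.2⟩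

/-- The profinite ring `Ẑ_C = ∏_{p ∈ Π} ℤ_p`. -/
abbrev ZHatPi (P : Set Nat.Primes) : Type :=
  ∀ p : P, ℤ_[((p : Nat.Primes) : ℕ)]

/-! ## The Magnus algebra -/

/-- The Magnus algebra `R⟨⟨X_A⟩⟩` of formal power series `∑ c_I X_I` in non-commuting variables
`X_a`, `a ∈ A`.  The series is given by its coefficients `I ↦ c_I`, where `I` runs through the
finite sequences of elements of `A`. -/
def MagnusAlgebra (R A : Type*) : Type _ := List A → R

namespace MagnusAlgebra

variable {R A : Type*}

instance [TopologicalSpace R] : TopologicalSpace (MagnusAlgebra R A) :=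
  inferInstanceAs (TopologicalSpace (List A → R))

section

variable [CommRing R]

instance : AddCommGroup (MagnusAlgebra R A) := inferInstanceAs (AddCommGroup (List A → R))

/-- `(∑ c_I X_I) (∑ d_I X_I) = ∑ e_I X_I` with `e_I` the sum of `c_J d_K` over all
decompositions `I = JK`. -/
instance : Mul (MagnusAlgebra R A) :=
  ⟨fun f g => fun I : List A => ∑ i ∈ Finset.range (I.length + 1), f (I.take i) * g (I.drop i)⟩

/-- The constant power series. -/
def const (c : R) : MagnusAlgebra R A
  | [] => c
  | _ :: _ => 0

instance : One (MagnusAlgebra R A) := ⟨const 1⟩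

open Classical in
/-- The variable `X_a`. -/
noncomputable def X (a : A) : MagnusAlgebra R A := fun I => if I = [a] then 1 else 0

theorem add_apply (f g : MagnusAlgebra R A) (I : List A) : (f + g) I = f I + g I := rfl

theorem zero_apply (I : List A) : (0 : MagnusAlgebra R A) I = 0 := rfl

theorem mul_apply (f g : MagnusAlgebra R A) (I : List A) :
    (f * g) I = ∑ i ∈ Finset.range (I.length + 1), f (I.take i) * g (I.drop i) := rfl

theorem one_def : (1 : MagnusAlgebra R A) = const 1 := rfl

theorem const_nil (c : R) : (const c : MagnusAlgebra R A) [] = c := rfl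

theorem const_of_ne (c : R) {I : List A} (h : I ≠ []) : (const c : MagnusAlgebra R A) I = 0 := by
  cases I with
  | nil => exact absurd rfl h
  | cons a l => rfl

theorem const_mul_apply (c : R) (f : MagnusAlgebra R A) (I : List A) :
    (const c * f : MagnusAlgebra R A) I = c * f I := by
  rw [mul_apply, Finset.sum_eq_single 0]
  · simp [const_nil]
  · intro i hi h0
    rw [const_of_ne, zero_mul]
    intro h
    have := congrArg List.length h
    simp only [Finset.mem_range, List.length_take, List.length_nil] at hi this
    omega
  · simp

theorem mul_const_apply (c : R) (f : MagnusAlgebra R A) (I : List A) :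
    (f * const c : MagnusAlgebra R A) I = f I * c := by
  rw [mul_apply, Finset.sum_eq_single I.length]
  · simp [const_nil]
  · intro i hi h0
    rw [const_of_ne, mul_zero]
    intro h
    have := congrArg List.length h
    simp only [Finset.mem_range, List.length_drop, List.length_nil] at hi this
    omega
  · simp

private theorem mul_assoc_aux (f g h : MagnusAlgebra R A) : f * g * h = f * (g * h) := by
  funext I
  simp only [mul_apply, Finset.sum_mul, Finset.mul_sum]
  rw [Finset.sum_sigma', Finset.sum_sigma']
  refine Finset.sum_bij' (fun x _ => ⟨x.2, x.1 - x.2⟩) (fun x _ => ⟨x.1 + x.2, x.1⟩)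
    ?_ ?_ ?_ ?_ ?_
  · rintro ⟨i, j⟩ h
    simp at h ⊢
    omega
  · rintro ⟨i, j⟩ h
    simp at h ⊢
    omega
  · rintro ⟨i, j⟩ h
    simp at h ⊢
    omega
  · rintro ⟨i, j⟩ h
    simp
  · rintro ⟨i, j⟩ h
    simp at h
    have h1 : j ≤ i := by omega
    have h2 : j + (i - j) = i := by omega
    simp only [List.take_take, List.drop_drop, List.drop_take, h2, min_eq_left h1, mul_assoc]

instance : Ring (MagnusAlgebra R A) where
  __ := (inferInstance : AddCommGroup (MagnusAlgebra R A))
  left_distrib f g h := by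
    funext I
    simp only [mul_apply, add_apply, mul_add, Finset.sum_add_distrib]
  right_distrib f g h := by
    funext I
    simp only [mul_apply, add_apply, add_mul, Finset.sum_add_distrib]
  zero_mul f := by
    funext I
    simp [mul_apply, zero_apply]
  mul_zero f := by
    funext I
    simp [mul_apply, zero_apply]
  mul_assoc := mul_assoc_aux
  one_mul f := by
    funext I
    rw [one_def, const_mul_apply, one_mul]
  mul_one f := by
    funext I
    rw [one_def, mul_const_apply, mul_one]

/-- The constant coefficient `∑ c_I X_I ↦ c_∅`, as a monoid homomorphism. -/
def constCoeff (R A : Type*) [CommRing R] : MagnusAlgebra R A →* R where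
  toFun f := f []
  map_one' := rfl
  map_mul' f g := by simp [mul_apply]

/-- The group `V_{R,A,1}` of all power series with constant coefficient `1`, inside the group of
units of the Magnus algebra. -/
def V (R A : Type*) [CommRing R] : Subgroup (MagnusAlgebra R A)ˣ :=
  (Units.map (constCoeff R A)).ker

end

end MagnusAlgebra

/-! ## Unipotent matrices -/

section Unipotent

variable {R : Type*} [CommRing R]

/-- The ideals `J_t = d^t R`. -/
def idealJ (d : R) (t : ℕ) : Ideal R := Ideal.span {d ^ t}

/-- The set `T_{n,t}(J)`, for `J_k = d^k R`, of all matrices with `a_{ij} = 0` for `j - i ≤ t - 1`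
and `a_{ij} ∈ J_{j-i}` for `i ≤ j`. -/
def triMat (n : ℕ) (d : R) (t : ℕ) : Set (Matrix (Fin n) (Fin n) R) :=
  {M | (∀ i j : Fin n, (j : ℤ) - (i : ℤ) ≤ (t : ℤ) - 1 → M i j = 0) ∧
    ∀ i j : Fin n, i ≤ j → M i j ∈ idealJ d ((j : ℕ) - (i : ℕ))}

theorem triMat_mul {n : ℕ} {d : R} {s t : ℕ} {M N : Matrix (Fin n) (Fin n) R}
    (hM : M ∈ triMat n d s) (hN : N ∈ triMat n d t) : M * N ∈ triMat n d (s + t) := by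
  refine ⟨fun i j hij => ?_, fun i j hij => ?_⟩
  · rw [Matrix.mul_apply]
    refine Finset.sum_eq_zero fun k _ => ?_
    by_cases h : (k : ℤ) - (i : ℤ) ≤ (s : ℤ) - 1
    · rw [hM.1 i k h, zero_mul]
    · rw [hN.1 k j (by push_cast at hij; omega), mul_zero]
  · rw [Matrix.mul_apply]
    refine Ideal.sum_mem _ fun k _ => ?_
    by_cases h : (k : ℤ) - (i : ℤ) ≤ (s : ℤ) - 1
    · rw [hM.1 i k h, zero_mul]
      exact Ideal.zero_mem _
    by_cases h' : (j : ℤ) - (k : ℤ) ≤ (t : ℤ) - 1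
    · rw [hN.1 k j h', mul_zero]
      exact Ideal.zero_mem _
    have h1 : i ≤ k := by rw [Fin.le_def]; omega
    have h2 : k ≤ j := by rw [Fin.le_def]; omega
    have h3 := Ideal.mul_mem_mul (hM.2 i k h1) (hN.2 k j h2)
    rw [idealJ, idealJ, Ideal.span_singleton_mul_span_singleton, ← pow_add] at h3
    rw [Fin.le_def] at h1 h2
    rwa [show (k : ℕ) - i + (j - k) = j - i by omega] at h3

/-- The ring `T_{n,0}(J)`, for `J_k = d^k R`. -/
def triRing (n : ℕ) (d : R) : Subring (Matrix (Fin n) (Fin n) R) where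
  carrier := triMat n d 0
  mul_mem' hM hN := triMat_mul hM hN
  one_mem' := by
    refine ⟨fun i j h => ?_, fun i j h => ?_⟩
    · refine Matrix.one_apply_ne fun h' => ?_
      subst h'
      simp at h
    · by_cases h' : i = j
      · subst h'
        simp [idealJ]
      · rw [Matrix.one_apply_ne h']
        exact Ideal.zero_mem _
  add_mem' {M N} hM hN := by
    refine ⟨fun i j h => ?_, fun i j h => ?_⟩
    · rw [Matrix.add_apply, hM.1 i j h, hN.1 i j h, add_zero]
    · exact Ideal.add_mem _ (hM.2 i j h) (hN.2 i j h)
  zero_mem' := ⟨fun _ _ _ => rfl, fun _ _ _ => Ideal.zero_mem _⟩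
  neg_mem' {M} hM := by
    refine ⟨fun i j h => ?_, fun i j h => ?_⟩
    · rw [Matrix.neg_apply, hM.1 i j h, neg_zero]
    · exact Ideal.neg_mem_iff _ |>.2 (hM.2 i j h)

theorem triMat_pow {n : ℕ} {d : R} {M : Matrix (Fin n) (Fin n) R} (hM : M ∈ triMat n d 1)
    (k : ℕ) : M ^ k ∈ triMat n d k := by
  induction k with
  | zero => rw [pow_zero]; exact (triRing n d).one_mem
  | succ k ih => rw [pow_succ]; exact triMat_mul ih hM

/-- The inverse of a unipotent matrix in `T_{n,0}(J)` is again one. -/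
theorem inv_mem_tri {n : ℕ} {d : R} (u : (Matrix (Fin n) (Fin n) R)ˣ)
    (hu : (u : Matrix (Fin n) (Fin n) R) ∈ triRing n d)
    (h1 : ∀ i, (u : Matrix (Fin n) (Fin n) R) i i = 1) :
    ((u⁻¹ : (Matrix (Fin n) (Fin n) R)ˣ) : Matrix (Fin n) (Fin n) R) ∈ triRing n d ∧
      ∀ i, ((u⁻¹ : (Matrix (Fin n) (Fin n) R)ˣ) : Matrix (Fin n) (Fin n) R) i i = 1 := by
  have hN : (1 - (u : Matrix (Fin n) (Fin n) R)) ∈ triMat n d 1 := by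
    have h0 : (1 - (u : Matrix (Fin n) (Fin n) R)) ∈ triRing n d :=
      (triRing n d).sub_mem (triRing n d).one_mem hu
    refine ⟨fun i j h => ?_, h0.2⟩
    by_cases hij : i = j
    · subst hij
      rw [Matrix.sub_apply, Matrix.one_apply_eq, h1, sub_self]
    · refine h0.1 i j ?_
      have : (i : ℕ) ≠ j := fun h => hij (Fin.ext h)
      push_cast at h ⊢
      omega
  have hpow : (1 - (u : Matrix (Fin n) (Fin n) R)) ^ n = 0 := by
    ext i j
    exact (triMat_pow hN n).1 i j (by have := i.2; have := j.2; omega)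
  have hinv : ((u⁻¹ : (Matrix (Fin n) (Fin n) R)ˣ) : Matrix (Fin n) (Fin n) R) =
      ∑ k ∈ Finset.range n, (1 - (u : Matrix (Fin n) (Fin n) R)) ^ k := by
    have h := mul_neg_geom_sum (1 - (u : Matrix (Fin n) (Fin n) R)) n
    rw [hpow, sub_zero, sub_sub_cancel] at h
    exact Units.inv_eq_of_mul_eq_one_right h
  have hmem : ((u⁻¹ : (Matrix (Fin n) (Fin n) R)ˣ) : Matrix (Fin n) (Fin n) R) ∈ triRing n d := by
    rw [hinv]
    refine (triRing n d).sum_mem fun k _ => (triRing n d).pow_mem ?_ k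
    exact (triRing n d).sub_mem (triRing n d).one_mem hu
  refine ⟨hmem, fun i => ?_⟩
  have h : ((u : Matrix (Fin n) (Fin n) R) *
      ((u⁻¹ : (Matrix (Fin n) (Fin n) R)ˣ) : Matrix (Fin n) (Fin n) R)) i i = 1 := by
    rw [Units.mul_inv, Matrix.one_apply_eq]
  rw [Matrix.mul_apply, Finset.sum_eq_single i, h1, one_mul] at h
  · exact h
  · intro k _ hk
    have hk' : (k : ℕ) ≠ i := fun h => hk (Fin.ext h)
    by_cases hlt : (k : ℕ) < i
    · rw [hu.1 i k (by push_cast; omega), zero_mul]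
    · rw [hmem.1 k i (by push_cast; omega), mul_zero]
  · simp

theorem mul_diag_tri {n : ℕ} {d : R} {M N : Matrix (Fin n) (Fin n) R}
    (hM : M ∈ triRing n d) (hN : N ∈ triRing n d) (h1 : ∀ i, M i i = 1) (h2 : ∀ i, N i i = 1)
    (i : Fin n) : (M * N) i i = 1 := by
  rw [Matrix.mul_apply, Finset.sum_eq_single i, h1, h2, one_mul]
  · intro k _ hk
    have hk' : (k : ℕ) ≠ i := fun h => hk (Fin.ext h)
    by_cases hlt : (k : ℕ) < i
    · rw [hM.1 i k (by push_cast; omega), zero_mul]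
    · rw [hN.1 k i (by push_cast; omega), mul_zero]
  · simp

/-- The group `U_n(J)`, for `J_k = d^k R`, of all unipotent matrices in `T_{n,0}(J)`: the matrices
in `T_{n,0}(J)` (which are upper triangular) with all diagonal entries `1`. -/
def unipJ (n : ℕ) (d : R) : Subgroup (Matrix (Fin n) (Fin n) R)ˣ where
  carrier := {u | (u : Matrix (Fin n) (Fin n) R) ∈ triRing n d ∧
    ∀ i, (u : Matrix (Fin n) (Fin n) R) i i = 1}
  mul_mem' hu hv := ⟨(triRing n d).mul_mem hu.1 hv.1, mul_diag_tri hu.1 hv.1 hu.2 hv.2⟩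
  one_mem' := ⟨(triRing n d).one_mem, fun i => Matrix.one_apply_eq i⟩
  inv_mem' {u} hu := inv_mem_tri u hu.1 hu.2

theorem mem_triRing_one_iff {n : ℕ} {M : Matrix (Fin n) (Fin n) R} :
    M ∈ triRing n (1 : R) ↔ ∀ i j, j < i → M i j = 0 := by
  constructor
  · intro h i j hij
    rw [Fin.lt_def] at hij
    exact h.1 i j (by push_cast; omega)
  · intro h
    refine ⟨fun i j hij => h i j ?_, fun i j _ => ?_⟩
    · rw [Fin.lt_def]
      push_cast at hij
      omega
    · simp [idealJ]

/-- The group `U_n(R)` of all upper-triangular unipotent `n × n` matrices over `R`. -/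
def unip (n : ℕ) (R : Type*) [CommRing R] : Subgroup (Matrix (Fin n) (Fin n) R)ˣ where
  carrier := {u | (∀ i j : Fin n, j < i → (u : Matrix (Fin n) (Fin n) R) i j = 0) ∧
    ∀ i, (u : Matrix (Fin n) (Fin n) R) i i = 1}
  mul_mem' {u v} hu hv := by
    have h := (unipJ n (1 : R)).mul_mem (x := u) (y := v) ⟨mem_triRing_one_iff.2 hu.1, hu.2⟩
      ⟨mem_triRing_one_iff.2 hv.1, hv.2⟩
    exact ⟨mem_triRing_one_iff.1 h.1, h.2⟩
  one_mem' := by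
    have h := (unipJ n (1 : R)).one_mem
    exact ⟨mem_triRing_one_iff.1 h.1, h.2⟩
  inv_mem' {u} hu := by
    have h := (unipJ n (1 : R)).inv_mem (x := u) ⟨mem_triRing_one_iff.2 hu.1, hu.2⟩
    exact ⟨mem_triRing_one_iff.1 h.1, h.2⟩

/-- For `x : A → U_n(J)` and a sequence `I = (a_1, …, a_t)`, the matrix
`M_I = (x(a_1) - 1) ⋯ (x(a_t) - 1)`. -/
def monomialMat {A : Type*} {n : ℕ} {d : R} (x : A → unipJ n d) (I : List A) :
    Matrix (Fin n) (Fin n) R :=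
  (I.map fun a => (((x a : unipJ n d) : (Matrix (Fin n) (Fin n) R)ˣ) :
    Matrix (Fin n) (Fin n) R) - 1).prod

/-- The set `L_J`, for `J_k = d^k R`, of all power series `∑ c_I X_I` over `R₀` such that
`c_∅ = 1` and `θ(c_I)` annihilates `J_t` for every sequence `I` of length `1 ≤ t < n`. -/
def magnusL {R₀ : Type*} [CommRing R₀] (A : Type*) (n : ℕ) (θ : R₀ →+* R) (d : R) :
    Set (MagnusAlgebra R₀ A) :=
  {f | f [] = 1 ∧
    ∀ I : List A, 1 ≤ I.length → I.length < n → θ (f I) ∈ (idealJ d I.length).annihilator}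

end Unipotent

universe u v w

/-! ## Filtered rings and weighted dimension subgroups of free groups -/

/-! The Magnus homomorphism comes from the universal property once $V$ is known to be pro-$\mathcal
C$. For that, and for $\mathbb U_n(\mathcal J)$, the test is that $g^{m_k}\to 1$ for a sequence of
$\Pi$-numbers $m_k$ (`isProPi_of_tendsto_pow`). It holds since $\binom{m_k}{i}\to 0$ in
$\hat{\mathbb Z}_{\mathcal C}$ for $i\ge 1$ and $g-1$ is nilpotent, coefficientwise or as a matrix.

A representation $\varphi$ extends to the Magnus algebra by $X_a\mapsto\varphi(\iota(a))-1$
(`evalAdd`): modulo an open ideal only finitely many $M_I$ survive. If $\theta(c_I)$ annihilates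
$J_{|I|}$, then $\theta(c_I)M_I=0$, so membership in $L_{\mathcal J}$ forces $\varphi(\sigma)=1$.
Conversely, for each word $I$ there is a representation whose corner entry at $\sigma$ is
$\theta(c_I)d^{|I|}$ (`monomialMat_seqUnip`). This is `mem_kerIntCont_iff`.

With $d=1$ and $\theta$ injective, part (2) becomes Magnus' theorem for $S$: $\sigma\in S^{(n)}$ if
and only if its coefficients of degrees $1,\dots,n-1$ vanish. One inclusion follows from the degree
filtration. For the other, let $K\supseteq S^{(n)}$ be open normal and $m=|S/K|$. An abstract word
$f$ near $\sigma$ has the same class modulo $K$, and its relevant coefficients are divisible by $m$.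
Giving weight $n$ to the generators in $K$ and weight $1$ to the finitely many others makes $f$
`IsTrivialInWeights`.

Such a word dies in $S/K$ by `CommFiltration.lift_eq_one`, through elimination of generators. A
generator $x$ of least weight is removed by writing the free group inside $F(Y\times\mathbb
N)\rtimes\langle x\rangle$, where $(y,j)$ stands for the $j$-fold commutator of $y$ with $x$, of
weight $w(y)+j\,w(x)$. The exponent of $x$ is divisible by $m$, as a substitution in dual numbers
shows. The left component is again trivial in the new weights, because the semidirect product acts
on polynomial sequences over any filtered ring. Quantifying over all filtered rings, and not only
over Magnus coefficients, is what makes triviality survive this passage. Once all weights are at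
least $n$, every generator is sent to $1$. -/

/-- A descending multiplicative filtration of a ring by additive subgroups. -/
structure MulFiltration (B : Type*) [Ring B] where
  /-- The terms of the filtration. -/
  toFun : ℕ → AddSubgroup B
  one_mem : (1 : B) ∈ toFun 0
  mul_mem : ∀ {i j : ℕ} {a b : B}, a ∈ toFun i → b ∈ toFun j → a * b ∈ toFun (i + j)
  anti : Antitone toFun

instance (B : Type*) [Ring B] : CoeFun (MulFiltration B) fun _ => ℕ → AddSubgroup B :=
  ⟨MulFiltration.toFun⟩

namespace MulFiltration

variable {B : Type*} [Ring B] (F : MulFiltration B)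

theorem mem_of_sub_one {i : ℕ} {a : B} (h : a - 1 ∈ F i) : a ∈ F 0 := by
  simpa using (F 0).add_mem (F.anti (Nat.zero_le i) h) F.one_mem

theorem mul_mem_right {i : ℕ} {a b : B} (ha : a ∈ F i) (hb : b ∈ F 0) : a * b ∈ F i :=
  F.mul_mem ha hb

theorem mul_mem_left {i : ℕ} {a b : B} (ha : a ∈ F 0) (hb : b ∈ F i) : a * b ∈ F i := by
  simpa using F.mul_mem ha hb

/-- The units congruent to `1` modulo the `i`-th term of a filtration. -/
def oneUnits (i : ℕ) : Subgroup Bˣ where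
  -- The condition on the inverse is not automatic, since `u⁻¹` need not lie in `F 0`.
  carrier := {u | (u : B) - 1 ∈ F i ∧ ((u⁻¹ : Bˣ) : B) - 1 ∈ F i}
  one_mem' := by simp
  mul_mem' {u v} hu hv := by
    constructor
    · have : ((u * v : Bˣ) : B) - 1 = ((u : B) - 1) * v + ((v : B) - 1) := by
        push_cast; noncomm_ring
      rw [this]
      exact (F i).add_mem (F.mul_mem_right hu.1 (F.mem_of_sub_one hv.1)) hv.1
    · have : (((u * v)⁻¹ : Bˣ) : B) - 1 =
          (((v⁻¹ : Bˣ) : B) - 1) * (u⁻¹ : Bˣ) + (((u⁻¹ : Bˣ) : B) - 1) := by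
        rw [mul_inv_rev]; push_cast; noncomm_ring
      rw [this]
      exact (F i).add_mem (F.mul_mem_right hv.2 (F.mem_of_sub_one hu.2)) hu.2
  inv_mem' {u} hu := ⟨hu.2, by simpa using hu.1⟩

theorem mem_oneUnits {i : ℕ} {u : Bˣ} :
    u ∈ F.oneUnits i ↔ (u : B) - 1 ∈ F i ∧ ((u⁻¹ : Bˣ) : B) - 1 ∈ F i := Iff.rfl

theorem oneUnits_anti {i j : ℕ} (h : i ≤ j) : F.oneUnits j ≤ F.oneUnits i :=
  fun _ hu => ⟨F.anti h hu.1, F.anti h hu.2⟩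

/-! ### Polynomial sequences over a filtered ring -/

/-- The difference operator on sequences. -/
def diff (B : Type*) [Ring B] : (ℤ → B) →+ (ℤ → B) where
  toFun φ s := φ (s + 1) - φ s
  map_zero' := by ext; simp
  map_add' φ ψ := by ext s; simp only [Pi.add_apply]; abel

@[simp] theorem diff_apply (φ : ℤ → B) (s : ℤ) : diff B φ s = φ (s + 1) - φ s := rfl

/-- Translation of sequences. -/
def shift (B : Type*) [Ring B] (e : ℤ) : (ℤ → B) →+ (ℤ → B) where
  toFun φ s := φ (s + e)
  map_zero' := rfl
  map_add' _ _ := rfl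

@[simp] theorem shift_apply (e : ℤ) (φ : ℤ → B) (s : ℤ) : shift B e φ s = φ (s + e) := rfl

/-- Sequences all of whose differences of order `l ≤ a` have values in `F (i + k * l)`. -/
def polyApprox (k : ℕ) : ℕ → ℕ → AddSubgroup (ℤ → B)
  | 0, i => AddSubgroup.pi Set.univ fun _ => F i
  | a + 1, i => AddSubgroup.pi Set.univ (fun _ => F i) ⊓ (polyApprox k a (i + k)).comap (diff B)

variable {F} {k : ℕ}

theorem mem_polyApprox_zero {i : ℕ} {φ : ℤ → B} :
    φ ∈ F.polyApprox k 0 i ↔ ∀ s, φ s ∈ F i := by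
  simp [polyApprox, AddSubgroup.mem_pi]

theorem mem_polyApprox_succ {a i : ℕ} {φ : ℤ → B} :
    φ ∈ F.polyApprox k (a + 1) i ↔ (∀ s, φ s ∈ F i) ∧ diff B φ ∈ F.polyApprox k a (i + k) := by
  simp [polyApprox, AddSubgroup.mem_pi]

theorem polyApprox_val {a i : ℕ} {φ : ℤ → B} (h : φ ∈ F.polyApprox k a i) (s : ℤ) : φ s ∈ F i := by
  cases a with
  | zero => exact mem_polyApprox_zero.1 h s
  | succ a => exact (mem_polyApprox_succ.1 h).1 s

theorem polyApprox_succ_le (a i : ℕ) : F.polyApprox k (a + 1) i ≤ F.polyApprox k a i := by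
  induction a generalizing i with
  | zero => exact fun φ h => mem_polyApprox_zero.2 (polyApprox_val h)
  | succ a ih =>
    exact fun φ h => mem_polyApprox_succ.2 ⟨polyApprox_val h, ih _ (mem_polyApprox_succ.1 h).2⟩

theorem polyApprox_anti (a : ℕ) : Antitone (F.polyApprox k a) := by
  induction a with
  | zero =>
    exact fun i j hij φ h => mem_polyApprox_zero.2 fun s => F.anti hij (mem_polyApprox_zero.1 h s)
  | succ a ih =>
    exact fun i j hij φ h => mem_polyApprox_succ.2 ⟨fun s => F.anti hij (polyApprox_val h s),
      ih (Nat.add_le_add_right hij k) (mem_polyApprox_succ.1 h).2⟩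

theorem shift_mem_polyApprox {a i : ℕ} {φ : ℤ → B} (h : φ ∈ F.polyApprox k a i) (e : ℤ) :
    shift B e φ ∈ F.polyApprox k a i := by
  induction a generalizing i φ with
  | zero => exact mem_polyApprox_zero.2 fun s => mem_polyApprox_zero.1 h _
  | succ a ih =>
    refine mem_polyApprox_succ.2 ⟨fun s => polyApprox_val h _, ?_⟩
    have : diff B (shift B e φ) = shift B e (diff B φ) := by
      ext s; simp [add_right_comm]
    rw [this]
    exact ih (mem_polyApprox_succ.1 h).2

theorem one_mem_polyApprox (a : ℕ) : (1 : ℤ → B) ∈ F.polyApprox k a 0 := by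
  cases a with
  | zero => exact mem_polyApprox_zero.2 fun s => F.one_mem
  | succ a =>
    refine mem_polyApprox_succ.2 ⟨fun s => F.one_mem, ?_⟩
    have : diff B 1 = 0 := by ext; simp
    rw [this]
    exact zero_mem _

/-- The Leibniz rule for differences,
$\Delta(\varphi\psi)=\Delta\varphi\cdot\psi(\cdot+1)+\varphi\cdot\Delta\psi$, reduces the order by
one. -/
theorem mul_mem_polyApprox {a i j : ℕ} {φ ψ : ℤ → B} (hφ : φ ∈ F.polyApprox k a i)
    (hψ : ψ ∈ F.polyApprox k a j) : φ * ψ ∈ F.polyApprox k a (i + j) := by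
  induction a generalizing i j φ ψ with
  | zero =>
    exact mem_polyApprox_zero.2 fun s =>
      F.mul_mem (mem_polyApprox_zero.1 hφ s) (mem_polyApprox_zero.1 hψ s)
  | succ a ih =>
    refine mem_polyApprox_succ.2
      ⟨fun s => F.mul_mem (polyApprox_val hφ s) (polyApprox_val hψ s), ?_⟩
    have : diff B (φ * ψ) = diff B φ * shift B 1 ψ + φ * diff B ψ := by
      ext s
      simp only [diff_apply, Pi.mul_apply, Pi.add_apply, shift_apply]
      noncomm_ring
    rw [this]
    refine add_mem ?_ ?_
    · have := ih (mem_polyApprox_succ.1 hφ).2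
        (shift_mem_polyApprox (polyApprox_succ_le _ _ hψ) 1)
      rwa [add_right_comm] at this
    · have := ih (polyApprox_succ_le _ _ hφ) (mem_polyApprox_succ.1 hψ).2
      rwa [← add_assoc] at this

variable (F k)

/-- Polynomial sequences with respect to a filtration. -/
def poly (i : ℕ) : AddSubgroup (ℤ → B) := ⨅ a, F.polyApprox k a i

variable {F k}

theorem mem_poly {i : ℕ} {φ : ℤ → B} : φ ∈ F.poly k i ↔ ∀ a, φ ∈ F.polyApprox k a i := by
  simp [poly, AddSubgroup.mem_iInf]

theorem diff_mem_poly {i : ℕ} {φ : ℤ → B} (h : φ ∈ F.poly k i) : diff B φ ∈ F.poly k (i + k) :=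
  mem_poly.2 fun a => (mem_polyApprox_succ.1 (mem_poly.1 h (a + 1))).2

theorem shift_mem_poly {i : ℕ} {φ : ℤ → B} (h : φ ∈ F.poly k i) (e : ℤ) :
    shift B e φ ∈ F.poly k i :=
  mem_poly.2 fun a => shift_mem_polyApprox (mem_poly.1 h a) e

theorem mul_mem_poly {i j : ℕ} {φ ψ : ℤ → B} (hφ : φ ∈ F.poly k i) (hψ : ψ ∈ F.poly k j) :
    φ * ψ ∈ F.poly k (i + j) :=
  mem_poly.2 fun a => mul_mem_polyApprox (mem_poly.1 hφ a) (mem_poly.1 hψ a)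

theorem one_mem_poly : (1 : ℤ → B) ∈ F.poly k 0 := mem_poly.2 one_mem_polyApprox

theorem poly_anti : Antitone (F.poly k) :=
  fun _ _ hij _ h => mem_poly.2 fun a => polyApprox_anti a hij (mem_poly.1 h a)

variable (F k)

/-- The filtration of the endomorphisms of the group of sequences by the amount by which they raise
the filtration of polynomial sequences. -/
def polyEnd : MulFiltration (AddMonoid.End (ℤ → B)) where
  toFun i :=
    { carrier := {T | ∀ l, ∀ φ ∈ F.poly k l, T φ ∈ F.poly k (l + i)}
      add_mem' := fun hS hT l φ hφ => add_mem (hS l φ hφ) (hT l φ hφ)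
      zero_mem' := fun l φ _ => zero_mem _
      neg_mem' := fun hT l φ hφ => neg_mem (hT l φ hφ) }
  one_mem := fun _ _ hφ => hφ
  mul_mem {i j S T} hS hT := fun l φ hφ => by
    have := hS _ _ (hT l φ hφ)
    rwa [add_assoc, add_comm j i] at this
  anti _ _ hij _ hT l φ hφ := poly_anti (Nat.add_le_add_left hij l) (hT l φ hφ)

end MulFiltration

/-- An element `f` of a free group, with weights on the basis, is `m`-trivial in weights `< n` if
under all substitutions of units `1 + b_x`, with `b_x` in the filtration step given by the weight of
`x`, in filtered rings of characteristic dividing `m` it becomes `1` modulo the `n`-th step. -/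
def IsTrivialInWeights {X : Type*} (m n : ℕ) (w : X → ℕ) (f : FreeGroup X) : Prop :=
  ∀ (B : Type) [Ring B] (F : MulFiltration B) (u : X → Bˣ), (m : B) = 0 →
    (∀ x, u x ∈ F.oneUnits (w x)) → ((FreeGroup.lift u f : Bˣ) : B) - 1 ∈ F n

/-- A filtration `G = G_0 ⊇ G_1 ⊇ …` by subgroups with `[G_i, G_j] ⊆ G_{i+j}`. -/
structure CommFiltration (G : Type*) [Group G] where
  /-- The terms of the filtration. -/
  toFun : ℕ → Subgroup G
  anti : Antitone toFun
  comm_mem : ∀ {i j : ℕ} {a b : G}, a ∈ toFun i → b ∈ toFun j → a * b * a⁻¹ * b⁻¹ ∈ toFun (i + j)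

instance (G : Type*) [Group G] : CoeFun (CommFiltration G) fun _ => ℕ → Subgroup G :=
  ⟨CommFiltration.toFun⟩

/-! ## The elimination of a generator -/

namespace Elimination

variable {Y : Type*} (n : ℕ)

/-- The image of `(y, j)` under the elimination automorphism. -/
def autFun (z : Y × ℕ) : FreeGroup (Y × ℕ) :=
  if z.2 + 1 < n then FreeGroup.of z * FreeGroup.of (z.1, z.2 + 1) else FreeGroup.of z

/-- The preimage of `(y, j)` under the elimination automorphism. -/
def autInvFun (y : Y) (j : ℕ) : FreeGroup (Y × ℕ) :=
  if j + 1 < n then FreeGroup.of (y, j) * (autInvFun y (j + 1))⁻¹ else FreeGroup.of (y, j)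
termination_by n - j

theorem autFun_autInvFun (y : Y) (j : ℕ) :
    FreeGroup.lift (autFun n) (autInvFun n y j) = FreeGroup.of (y, j) := by
  rw [autInvFun]
  split_ifs with h
  · rw [map_mul, map_inv, autFun_autInvFun y (j + 1), FreeGroup.lift_apply_of, autFun, if_pos h]
    simp
  · rw [FreeGroup.lift_apply_of, autFun, if_neg h]
termination_by n - j

/-- The elimination automorphism `(y, j) ↦ (y, j) (y, j + 1)` of a free group, which fixes `(y, j)`
for `n ≤ j + 1`. -/
def aut : FreeGroup (Y × ℕ) ≃* FreeGroup (Y × ℕ) :=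
  MonoidHom.toMulEquiv (FreeGroup.lift (autFun n))
    (FreeGroup.lift fun z => autInvFun n z.1 z.2)
    (by
      ext z
      simp only [MonoidHom.comp_apply, FreeGroup.lift_apply_of, MonoidHom.id_apply]
      rw [autFun]
      split_ifs with h
      · rw [map_mul, FreeGroup.lift_apply_of, FreeGroup.lift_apply_of, autInvFun, if_pos h]
        simp
      · rw [FreeGroup.lift_apply_of, autInvFun, if_neg h])
    (by
      ext z
      simp [autFun_autInvFun])

theorem aut_of (z : Y × ℕ) : aut n (FreeGroup.of z) = autFun n z :=
  FreeGroup.lift_apply_of ..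

/-- The action of `ℤ` by powers of the elimination automorphism. -/
def act : Multiplicative ℤ →* MulAut (FreeGroup (Y × ℕ)) := zpowersHom (MulAut _) (aut n)

theorem act_one : act n (Multiplicative.ofAdd 1) = aut (Y := Y) n := by
  simp [act]

theorem act_add_one (s : ℤ) (g : FreeGroup (Y × ℕ)) :
    act n (Multiplicative.ofAdd (s + 1)) g = act n (Multiplicative.ofAdd s) (aut n g) := by
  rw [ofAdd_add, map_mul, MulAut.mul_apply, act_one]

/-- The semidirect product of the new free group with the cyclic group generated by the eliminated
generator. -/
abbrev Semi (Y : Type*) (n : ℕ) : Type _ := FreeGroup (Y × ℕ) ⋊[act n] Multiplicative ℤ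

/-! ### The semidirect product acting on sequences -/

section Action

variable {B : Type*} [Ring B] (u : Y × ℕ → Bˣ)

/-- The sequence of the values of the translates of an element of the free group. -/
def orbit (g : FreeGroup (Y × ℕ)) (s : ℤ) : Bˣ :=
  FreeGroup.lift u (act n (Multiplicative.ofAdd s) g)

theorem orbit_mul (g h : FreeGroup (Y × ℕ)) (s : ℤ) :
    orbit n u (g * h) s = orbit n u g s * orbit n u h s := by simp [orbit]

theorem orbit_add_one (g : FreeGroup (Y × ℕ)) (s : ℤ) :
    orbit n u g (s + 1) = orbit n u (aut n g) s := by rw [orbit, act_add_one, orbit]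

/-- The action of the semidirect product on sequences. -/
def seqAction : Semi Y n →* AddMonoid.End (ℤ → B) where
  toFun t :=
    { toFun := fun φ s => orbit n u t.left s * φ (s + t.right.toAdd)
      map_zero' := by ext; simp
      map_add' := fun φ ψ => by ext; simp [mul_add] }
  map_one' := by
    ext φ s
    change ((orbit n u 1 s : Bˣ) : B) * φ (s + 0) = φ s
    simp [orbit]
  map_mul' t t' := by
    ext φ s
    change ((orbit n u (t.left * act n t.right t'.left) s : Bˣ) : B) *
        φ (s + (t.right.toAdd + t'.right.toAdd)) =
      orbit n u t.left s * (orbit n u t'.left (s + t.right.toAdd) *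
        φ (s + t.right.toAdd + t'.right.toAdd))
    rw [orbit_mul, Units.val_mul, mul_assoc, add_assoc]
    congr 3
    unfold orbit
    rw [ofAdd_add, map_mul]
    rfl

theorem seqAction_sub_one_apply (t : Semi Y n) (φ : ℤ → B) (s : ℤ) :
    (((seqAction n u).toHomUnits t : AddMonoid.End (ℤ → B)) - 1) φ s =
      orbit n u t.left s * φ (s + t.right.toAdd) - φ s := rfl

variable (F : MulFiltration B) (k : ℕ) (w : Y → ℕ)

/-- The values at $s+1$ and $s$ differ by the factor belonging to $(y,j+1)$, which lies deeper in
the filtration. So membership spreads from $s=0$ to all integers, by descending recursion on $j$. -/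
theorem orbit_mem_oneUnits (hu : ∀ z, u z ∈ F.oneUnits (w z.1 + z.2 * k)) (y : Y) (j : ℕ) (s : ℤ) :
    orbit n u (FreeGroup.of (y, j)) s ∈ F.oneUnits (w y + j * k) := by
  have h0 : orbit n u (FreeGroup.of (y, j)) 0 ∈ F.oneUnits (w y + j * k) := by
    simpa [orbit] using hu (y, j)
  have hstep : ∀ s, orbit n u (FreeGroup.of (y, j)) (s + 1) ∈ F.oneUnits (w y + j * k) ↔
      orbit n u (FreeGroup.of (y, j)) s ∈ F.oneUnits (w y + j * k) := by
    intro s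
    rw [orbit_add_one, aut_of, autFun]
    split_ifs with h
    · rw [orbit_mul]
      refine Subgroup.mul_mem_cancel_right _ (F.oneUnits_anti ?_ (orbit_mem_oneUnits hu y (j + 1) s))
      gcongr
      omega
    · rfl
  induction s using Int.induction_on with
  | zero => exact h0
  | succ i ih => exact (hstep _).2 ih
  | pred i ih => exact (hstep _).1 (by simpa using ih)
termination_by n - j

/-- The sequence of the translates of a generator is polynomial. -/
theorem orbit_sub_one_mem_poly (hu : ∀ z, u z ∈ F.oneUnits (w z.1 + z.2 * k)) (y : Y) (j : ℕ) :
    (fun s => (orbit n u (FreeGroup.of (y, j)) s : B)) - 1 ∈ F.poly k (w y + j * k) ∧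
    (fun s => (((orbit n u (FreeGroup.of (y, j)) s)⁻¹ : Bˣ) : B)) - 1 ∈
      F.poly k (w y + j * k) := by
  suffices H : ∀ a j,
      (fun s => (orbit n u (FreeGroup.of (y, j)) s : B)) - 1 ∈ F.polyApprox k a (w y + j * k) ∧
      (fun s => (((orbit n u (FreeGroup.of (y, j)) s)⁻¹ : Bˣ) : B)) - 1 ∈
        F.polyApprox k a (w y + j * k) from
    ⟨MulFiltration.mem_poly.2 fun a => (H a j).1, MulFiltration.mem_poly.2 fun a => (H a j).2⟩
  -- Induction on the order of the differences, for all $j$ at once, because the first difference at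
  -- $j$ involves the sequence at $j+1$.
  intro a
  induction a with
  | zero =>
    intro j
    have h := fun s => orbit_mem_oneUnits n u F k w hu y j s
    exact ⟨MulFiltration.mem_polyApprox_zero.2 fun s => (h s).1,
      MulFiltration.mem_polyApprox_zero.2 fun s => (h s).2⟩
  | succ a ih =>
    intro j
    have h := fun s => orbit_mem_oneUnits n u F k w hu y j s
    have key : ∀ φ : ℤ → B, φ - 1 ∈ F.polyApprox k a (w y + j * k) → φ ∈ F.polyApprox k a 0 := by
      intro φ hφ
      simpa using add_mem (MulFiltration.polyApprox_anti a (Nat.zero_le _) hφ)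
        (MulFiltration.one_mem_polyApprox a)
    rw [MulFiltration.mem_polyApprox_succ, MulFiltration.mem_polyApprox_succ]
    refine ⟨⟨fun s => (h s).1, ?_⟩, ⟨fun s => (h s).2, ?_⟩⟩
    · by_cases hj : j + 1 < n
      · have : MulFiltration.diff B ((fun s => (orbit n u (FreeGroup.of (y, j)) s : B)) - 1) =
            (fun s => (orbit n u (FreeGroup.of (y, j)) s : B)) *
              ((fun s => (orbit n u (FreeGroup.of (y, j + 1)) s : B)) - 1) := by
          ext s
          simp [orbit_add_one, aut_of, autFun, hj, orbit_mul, mul_sub]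
        rw [this]
        have := MulFiltration.mul_mem_polyApprox (key _ (ih j).1) (ih (j + 1)).1
        rwa [zero_add, add_mul, one_mul, ← add_assoc] at this
      -- The automorphism fixes the last generators, so their sequences are constant.
      · have : MulFiltration.diff B ((fun s => (orbit n u (FreeGroup.of (y, j)) s : B)) - 1) = 0 := by
          ext s
          simp [orbit_add_one, aut_of, autFun, hj]
        rw [this]
        exact zero_mem _
    · by_cases hj : j + 1 < n
      · have : MulFiltration.diff B
              ((fun s => (((orbit n u (FreeGroup.of (y, j)) s)⁻¹ : Bˣ) : B)) - 1) =
            ((fun s => (((orbit n u (FreeGroup.of (y, j + 1)) s)⁻¹ : Bˣ) : B)) - 1) *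
              (fun s => (((orbit n u (FreeGroup.of (y, j)) s)⁻¹ : Bˣ) : B)) := by
          ext s
          simp [orbit_add_one, aut_of, autFun, hj, orbit_mul, sub_mul]
        rw [this]
        have := MulFiltration.mul_mem_polyApprox (ih (j + 1)).2 (key _ (ih j).2)
        rwa [add_zero, add_mul, one_mul, ← add_assoc] at this
      · have : MulFiltration.diff B
            ((fun s => (((orbit n u (FreeGroup.of (y, j)) s)⁻¹ : Bˣ) : B)) - 1) = 0 := by
          ext s
          simp [orbit_add_one, aut_of, autFun, hj]
        rw [this]
        exact zero_mem _

/-- A generator $y$ acts by multiplication with a sequence that is $1$ plus a polynomial sequence of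
weight $w(y)$. -/
theorem seqAction_inl_sub_one_mem (hu : ∀ z, u z ∈ F.oneUnits (w z.1 + z.2 * k)) (y : Y) :
    (seqAction n u).toHomUnits (SemidirectProduct.inl (FreeGroup.of (y, 0))) ∈
      (F.polyEnd k).oneUnits (w y) := by
  have h := orbit_sub_one_mem_poly n u F k w hu y 0
  rw [zero_mul, add_zero] at h
  constructor
  · intro l φ hφ
    have := MulFiltration.mul_mem_poly h.1 hφ
    rw [add_comm] at this
    convert this using 1
    ext s
    rw [seqAction_sub_one_apply]
    simp [sub_mul]
  · intro l φ hφ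
    have := MulFiltration.mul_mem_poly h.2 hφ
    rw [add_comm] at this
    convert this using 1
    ext s
    rw [← map_inv, seqAction_sub_one_apply, ← map_inv]
    simp [sub_mul, orbit]

/-- The eliminated generator acts as the translation $T$. Here $T-1=\Delta$ and
$T^{-1}-1=-T^{-1}\Delta$, and $\Delta$ raises the filtration by $k$ by the very definition of
polynomial sequences. -/
theorem seqAction_inr_sub_one_mem :
    (seqAction n u).toHomUnits (SemidirectProduct.inr (Multiplicative.ofAdd 1)) ∈
      (F.polyEnd k).oneUnits k := by
  constructor
  · intro l φ hφ
    convert MulFiltration.diff_mem_poly hφ using 1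
    ext s
    rw [seqAction_sub_one_apply]
    simp [orbit]
  · intro l φ hφ
    convert neg_mem (MulFiltration.shift_mem_poly (MulFiltration.diff_mem_poly hφ) (-1)) using 1
    ext s
    rw [← map_inv, seqAction_sub_one_apply, ← map_inv]
    simp [orbit]

end Action

end Elimination

/-! ### Weights under the elimination of a generator -/

namespace Elimination

variable {X : Type*} (x : X) (n : ℕ)

open Classical in
/-- The homomorphism from the free group on `X` into the semidirect product that results from the
elimination of `x`. -/
noncomputable def toSemi : FreeGroup X →* Semi {y : X // y ≠ x} n :=
  FreeGroup.lift fun z => if h : z = x then SemidirectProduct.inr (Multiplicative.ofAdd 1)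
    else SemidirectProduct.inl (FreeGroup.of (⟨z, h⟩, 0))

theorem toSemi_of_self : toSemi x n (FreeGroup.of x) =
    SemidirectProduct.inr (Multiplicative.ofAdd 1) := by
  simp [toSemi]

theorem toSemi_of_ne (y : {y : X // y ≠ x}) : toSemi x n (FreeGroup.of (y : X)) =
    SemidirectProduct.inl (FreeGroup.of (y, 0)) := by
  simp [toSemi, y.2]

variable {x n}

theorem lift_toHomUnits {M : Type*} [Monoid M] (τ : Semi {y : X // y ≠ x} n →* M)
    (f : FreeGroup X) :
    ((FreeGroup.lift (fun z => τ.toHomUnits (toSemi x n (FreeGroup.of z))) f : Mˣ) : M) =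
      τ (toSemi x n f) := by
  have : FreeGroup.lift (fun z => τ.toHomUnits (toSemi x n (FreeGroup.of z))) =
      τ.toHomUnits.comp (toSemi x n) := by
    ext z
    simp
  rw [this]
  rfl

/-- The new weights after the elimination of `x`. -/
def newWeight (x : X) (w : X → ℕ) (z : {y : X // y ≠ x} × ℕ) : ℕ := w z.1 + z.2 * w x

/-- A substitution of the new generators in $B$ induces one of the old generators in the
endomorphisms of $B$-valued sequences, filtered by the effect on polynomial sequences, where $m=0$
still holds. Triviality of $f$ in that ring gives the claim over $B$. -/
theorem isTrivialInWeights_left {m : ℕ} {w : X → ℕ} {f : FreeGroup X}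
    (hf : IsTrivialInWeights m n w f) :
    IsTrivialInWeights m n (newWeight x w) (toSemi x n f).left := by
  intro B _ F u hm hu
  have := hf (AddMonoid.End (ℤ → B)) (F.polyEnd (w x))
    (fun z => (seqAction n u).toHomUnits (toSemi x n (FreeGroup.of z))) ?_ ?_
  · rw [lift_toHomUnits] at this
    -- Applied to the constant sequence $1$ and read off at $0$, the operator returns the value of
    -- the left component.
    have := this 0 1 MulFiltration.one_mem_poly
    rw [zero_add] at this
    have := MulFiltration.polyApprox_val (MulFiltration.mem_poly.1 this 0) 0
    have h2 : (seqAction n u (toSemi x n f) - 1 : AddMonoid.End (ℤ → B)) 1 0 =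
      orbit n u (toSemi x n f).left 0 * (1 : ℤ → B) (0 + (toSemi x n f).right.toAdd) -
        (1 : ℤ → B) 0 := rfl
    rw [h2] at this
    simpa [orbit] using this
  · ext φ s
    have : ((m : AddMonoid.End (ℤ → B)) φ) s = (m : B) * φ s := by
      rw [← nsmul_one]
      simp
    rw [this, hm]
    simp
  · intro z
    by_cases h : z = x
    · subst h
      rw [toSemi_of_self]
      exact seqAction_inr_sub_one_mem n u F (w z)
    · have h2 := toSemi_of_ne x n ⟨z, h⟩
      simp only at h2
      rw [h2]
      exact seqAction_inl_sub_one_mem n u F (w x) (fun y => w y) hu ⟨z, h⟩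

/-- The filtration of the dual numbers by `1, ε, …, ε, 0, …`. -/
def dualFiltration (R : Type*) [CommRing R] (k : ℕ) : MulFiltration (DualNumber R) where
  toFun i :=
    { carrier := {a | (1 ≤ i → a.fst = 0) ∧ (k < i → a.snd = 0)}
      add_mem' := fun {a b} ha hb =>
        ⟨fun h => by simp [ha.1 h, hb.1 h], fun h => by simp [ha.2 h, hb.2 h]⟩
      zero_mem' := by simp
      neg_mem' := fun {a} ha => ⟨fun h => by simp [ha.1 h], fun h => by simp [ha.2 h]⟩ }
  one_mem := ⟨fun h => absurd h (by norm_num), fun h => absurd h (by omega)⟩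
  mul_mem {i j a b} ha hb := by
    refine ⟨fun h => ?_, fun h => ?_⟩
    · rcases Nat.eq_zero_or_pos i with rfl | hi
      · simp [hb.1 (by omega)]
      · simp [ha.1 hi]
    · rw [DualNumber.snd_mul]
      rcases Nat.eq_zero_or_pos i with rfl | hi
      · simp [hb.1 (by omega), hb.2 (by omega)]
      rcases Nat.eq_zero_or_pos j with rfl | hj
      · simp [ha.1 hi, ha.2 (by omega)]
      · simp [ha.1 hi, hb.1 hj]
  anti i j hij a ha := ⟨fun h => ha.1 (h.trans hij), fun h => ha.2 (h.trans_le hij)⟩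

/-- The homomorphism `e ↦ 1 + e ε`. -/
def expDual (R : Type*) [CommRing R] : Multiplicative ℤ →* DualNumber R where
  toFun e := 1 + TrivSqZeroExt.inr ((e.toAdd : ℤ) : R)
  map_one' := by simp
  map_mul' a b := by
    ext <;> simp [add_comm]

/-- Send $x$ to $1+\varepsilon$ and all other generators to $1$ in the dual numbers over $\mathbb
Z/m$. Then $f$ becomes $1+e\varepsilon$ with $e$ the exponent of $x$, and $\varepsilon$ survives
below weight $n$ because $w(x)<n$. -/
theorem dvd_right {m : ℕ} {w : X → ℕ} (hx : w x < n) (h1 : 1 ≤ w x) {f : FreeGroup X}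
    (hf : IsTrivialInWeights m n w f) : (m : ℤ) ∣ (toSemi x n f).right.toAdd := by
  let τ : Semi {y : X // y ≠ x} n →* DualNumber (ZMod m) :=
    (expDual (ZMod m)).comp SemidirectProduct.rightHom
  have := hf (DualNumber (ZMod m)) (dualFiltration (ZMod m) (w x))
    (fun z => τ.toHomUnits (toSemi x n (FreeGroup.of z))) ?_ ?_
  · rw [lift_toHomUnits] at this
    have := this.2 hx
    simpa [τ, expDual, ZMod.intCast_zmod_eq_zero_iff_dvd] using this
  · ext <;> simp
  · intro z
    have key : ∀ t : Semi {y : X // y ≠ x} n, τ t - 1 ∈ dualFiltration (ZMod m) (w x) (w z) →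
        τ t⁻¹ - 1 ∈ dualFiltration (ZMod m) (w x) (w z) →
        τ.toHomUnits t ∈ (dualFiltration (ZMod m) (w x)).oneUnits (w z) := by
      intro t ht ht'
      rw [MulFiltration.mem_oneUnits, ← map_inv]
      exact ⟨ht, ht'⟩
    by_cases h : z = x
    · subst h
      rw [toSemi_of_self]
      refine key _ ⟨fun _ => ?_, fun h => absurd h (lt_irrefl _)⟩
        ⟨fun _ => ?_, fun h => absurd h (lt_irrefl _)⟩ <;> simp [τ, expDual]
    · have h2 := toSemi_of_ne x n ⟨z, h⟩
      simp only at h2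
      rw [h2]
      refine key _ ?_ ?_ <;> simp [τ, zero_mem]

/-! ### Elimination in a filtered group -/

section Group

variable {G : Type*} [Group G] (g : X → G)

/-- The substitution of commutators for the new generators. -/
def newElt (x : X) (g : X → G) (y : {y : X // y ≠ x}) : ℕ → G
  | 0 => g y
  | j + 1 => (newElt x g y j)⁻¹ * (g x * newElt x g y j * (g x)⁻¹)

theorem newElt_mem (Γ : CommFiltration G) {w : X → ℕ} (hg : ∀ z, g z ∈ Γ (w z))
    (z : {y : X // y ≠ x} × ℕ) : newElt x g z.1 z.2 ∈ Γ (newWeight x w z) := by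
  obtain ⟨y, j⟩ := z
  induction j with
  | zero => simpa [newElt, newWeight] using hg y
  | succ j ih =>
    have := Γ.comm_mem (inv_mem ih) (hg x)
    rw [newWeight] at this ⊢
    simpa only [newElt, Nat.add_mul, one_mul, ← add_assoc, inv_inv,
      mul_assoc] using this

/-- The homomorphism from the semidirect product that is induced by a substitution. -/
def semiLift (g : X → G) (h : ∀ y, ∀ j, n ≤ j → newElt x g y j = 1) :
    Semi {y : X // y ≠ x} n →* G :=
  SemidirectProduct.lift (FreeGroup.lift fun z => newElt x g z.1 z.2) (zpowersHom G (g x)) (by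
    have hone : ∀ a, FreeGroup.lift (fun z => newElt x g z.1 z.2) (aut n a) =
        g x * FreeGroup.lift (fun z => newElt x g z.1 z.2) a * (g x)⁻¹ := by
      intro a
      have : (FreeGroup.lift (fun z => newElt x g z.1 z.2)).comp (aut n).toMonoidHom =
          (MulAut.conj (g x)).toMonoidHom.comp
            (FreeGroup.lift fun z => newElt x g z.1 z.2) := by
        ext z
        simp only [MonoidHom.comp_apply, MulEquiv.coe_toMonoidHom, aut_of, autFun,
          FreeGroup.lift_apply_of, MulAut.conj_apply]
        split_ifs with hz
        · rw [map_mul, FreeGroup.lift_apply_of, FreeGroup.lift_apply_of, newElt]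
          group
        · rw [FreeGroup.lift_apply_of]
          -- At the truncation the automorphism fixes the generator. This agrees with conjugation
          -- because the next commutator is already $1$.
          have := h z.1 (z.2 + 1) (by omega)
          rw [newElt, inv_mul_eq_one] at this
          exact this
      exact DFunLike.congr_fun this a
    intro e
    induction e using Multiplicative.rec with | _ e => ?_
    ext1 z
    simp only [MonoidHom.comp_apply, MulEquiv.coe_toMonoidHom, MulAut.conj_apply,
      zpowersHom_apply, toAdd_ofAdd]
    generalize FreeGroup.of z = a
    induction e using Int.induction_on generalizing a with
    | zero => simp
    | succ i ih => rw [act_add_one, ih, hone, zpow_add_one]; group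
    | pred i ih =>
      -- For negative exponents, the one-step relation is used at the preimage of `a` under the
      -- automorphism.
      have h3 := act_add_one (Y := {y : X // y ≠ x}) n (-(i : ℤ) - 1) ((aut n).symm a)
      rw [sub_add_cancel, MulEquiv.apply_symm_apply] at h3
      rw [← h3, ih, zpow_sub_one]
      have h4 := hone ((aut n).symm a)
      rw [MulEquiv.apply_symm_apply] at h4
      rw [h4]
      group)

/-- Evaluation at `g` factors through the semidirect product, as the generators $(y,0)$ and $x$
already show. Reading a pair as a product splits off a power of `g x`. -/
theorem lift_eq_semiLift (h : ∀ y, ∀ j, n ≤ j → newElt x g y j = 1) (f : FreeGroup X) :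
    FreeGroup.lift g f = FreeGroup.lift (fun z => newElt x g z.1 z.2) (toSemi x n f).left *
      g x ^ (toSemi x n f).right.toAdd := by
  have : FreeGroup.lift g = (semiLift g h).comp (toSemi x n) := by
    ext z
    rw [FreeGroup.lift_apply_of, MonoidHom.comp_apply]
    by_cases hz : z = x
    · subst hz
      simp [toSemi_of_self, semiLift]
    · have h2 := toSemi_of_ne x n ⟨z, hz⟩
      simp only at h2
      simp [h2, semiLift, newElt]
  rw [this]
  rfl

end Group

end Elimination

open Elimination

universe y

/-- A word that is `m`-trivial in weights `< n` vanishes in every group of exponent dividing `m`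
with a filtration of length `n`, whenever the substituted elements lie in the filtration steps
prescribed by the weights. -/
theorem CommFiltration.lift_eq_one {G : Type*} [Group G] (Γ : CommFiltration G) {m n : ℕ}
    (hn : Γ n = ⊥) (hm : ∀ g : G, g ^ m = 1) {X : Type y} (w : X → ℕ) (g : X → G)
    (hw : ∀ x, 1 ≤ w x) (hfin : {x | w x < n}.Finite) (hg : ∀ x, g x ∈ Γ (w x)) {f : FreeGroup X}
    (hf : IsTrivialInWeights m n w f) : FreeGroup.lift g f = 1 := by
  have hbot : ∀ i, n ≤ i → ∀ a ∈ Γ i, a = 1 := fun i hi a ha => by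
    simpa [hn] using Γ.anti hi ha
  -- Here $k$ bounds the weights from below, and `c` counts the generators of weight exactly $k$.
  -- The induction is on $n-k$, bounded by `d`, and then on `c`. The generating set is quantified
  -- inside because elimination changes it.
  suffices H : ∀ d k : ℕ, n ≤ k + d → 1 ≤ k → ∀ c, ∀ {X : Type y} (w : X → ℕ) (g : X → G),
      (∀ x, k ≤ w x) → {x | w x < n}.Finite → {x | w x = k}.ncard = c →
      (∀ x, g x ∈ Γ (w x)) → ∀ {f : FreeGroup X},
      IsTrivialInWeights m n w f → FreeGroup.lift g f = 1 from
    H n 1 (by omega) le_rfl _ w g hw hfin rfl hg hf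
  clear hf hg hfin hw g w f X
  intro d
  induction d with
  | zero =>
    intro k hk _ c X w g hw _ _ hg f _
    have : FreeGroup.lift g = 1 := by
      ext x
      simpa using hbot _ (hk.trans (hw x)) _ (hg x)
    rw [this, MonoidHom.one_apply]
  | succ d ihd =>
    intro k hk h1 c
    rcases le_or_gt n k with hnk | hkn
    · exact ihd k (by omega) h1 c
    induction c with
    | zero =>
      intro X w g hw hfin hc hg f hf
      have hfink : {x | w x = k}.Finite := hfin.subset fun x hx => by
        simp only [Set.mem_ofPred_eq] at hx ⊢; omega
      rw [Set.ncard_eq_zero hfink] at hc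
      refine ihd (k + 1) (by omega) (by omega) _ w g (fun x => ?_) hfin rfl hg hf
      have h2 : w x ≠ k := fun h => by
        have : x ∈ {x | w x = k} := h
        simp [hc] at this
      have := hw x
      omega
    | succ c ih =>
      intro X w g hw hfin hc hg f hf
      obtain ⟨x, hx⟩ : {x | w x = k}.Nonempty := Set.nonempty_of_ncard_ne_zero (by omega)
      have hx : w x = k := hx
      have hmem := newElt_mem (x := x) g Γ hg
      -- Each commutator with $x$ raises the weight by $w(x)\ge 1$, so $n$ of them reach the trivial
      -- step.
      have htriv : ∀ y, ∀ j, n ≤ j → newElt x g y j = 1 := fun y j hj => by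
        refine hbot _ ?_ _ (hmem (y, j))
        have : j * 1 ≤ j * w x := Nat.mul_le_mul_left _ (by omega)
        simp only [newWeight]
        omega
      rw [lift_eq_semiLift g htriv]
      -- The exponent of $x$ is a multiple of $m$, so the power of `g x` disappears.
      obtain ⟨q, hq⟩ := dvd_right (x := x) (by omega) (by omega) hf
      rw [hq, zpow_mul, zpow_natCast, hm, one_zpow, mul_one]
      refine ih (newWeight x w) _ (fun z => (hw z.1).trans (Nat.le_add_right _ _)) ?_ ?_ hmem
        (isTrivialInWeights_left hf)
      · refine Set.Finite.subset (Set.Finite.prod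
          (hfin.preimage Subtype.val_injective.injOn)
          (Set.finite_lt_nat n)) (fun z hz => ?_)
        have : z.2 * 1 ≤ z.2 * w x := Nat.mul_le_mul_left _ (by omega)
        change w z.1 + z.2 * w x < n at hz
        simp only [Set.mem_prod, Set.mem_preimage, Set.mem_ofPred_eq]
        omega
      -- As $w(x)=k\ge 1$ and $w(y)\ge k$, new weight $k$ forces $j=0$. The generators of weight $k$
      -- are the old ones without $x$, one fewer than before.
      · have : {z | newWeight x w z = k} =
            (fun y : {y : X // y ≠ x} => (y, 0)) '' {y | w y = k} := by
          ext ⟨y, j⟩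
          have := hw y
          simp only [newWeight, Set.mem_ofPred_eq, Set.mem_image, Prod.mk.injEq]
          constructor
          · intro h
            have h3 : j * w x = 0 := by omega
            have h4 : j = 0 := by
              rcases Nat.mul_eq_zero.1 h3 with h | h <;> omega
            exact ⟨y, by omega, rfl, h4.symm⟩
          · rintro ⟨y', h, rfl, rfl⟩
            simpa using h
        rw [this, Set.ncard_image_of_injective _ (fun a b h => (Prod.mk.inj h).1)]
        have h5 : (Subtype.val : {y : X // y ≠ x} → X) '' {y | w y = k} =
            {z | w z = k} \ {x} := by
          ext z
          simp [and_comm]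
        rw [← Set.ncard_image_of_injective _ Subtype.val_injective, h5,
          Set.ncard_sdiff_singleton_of_mem (s := {z | w z = k}) hx, hc]
        rfl

open Filter

/-! ## Pro-`Π` groups -/

/-- A natural number all of whose prime divisors lie in `P`. -/
def IsPiNumber (P : Set Nat.Primes) (m : ℕ) : Prop :=
  m ≠ 0 ∧ ∀ p : Nat.Primes, (p : ℕ) ∣ m → p ∈ P

/-- If $p$ divides the order of a finite quotient, Cauchy's theorem gives an element of order $p$.
Some power of it with exponent $m_k$ is trivial, so $p\mid m_k$ and $p\in\Pi$. -/
theorem isProPi_of_tendsto_pow {P : Set Nat.Primes} {G : Type*} [Group G] [TopologicalSpace G]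
    [IsTopologicalGroup G] [CompactSpace G] [T2Space G] [TotallyDisconnectedSpace G] (m : ℕ → ℕ)
    (hm : ∀ k, IsPiNumber P (m k)) (h : ∀ g : G, Tendsto (fun k => g ^ m k) atTop (𝓝 1)) :
    IsProPi P G where
  compact := inferInstance
  t2 := inferInstance
  totallyDisconnected := inferInstance
  quotient N _ hN := by
    have hfin : Finite (G ⧸ N) := N.quotient_finite_of_isOpen hN
    refine ⟨hfin, fun p hp => ?_⟩
    have : Fact (Nat.Prime (p : ℕ)) := ⟨p.2⟩
    obtain ⟨x, hx⟩ := exists_prime_orderOf_dvd_card' (p : ℕ) hp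
    obtain ⟨g, rfl⟩ := QuotientGroup.mk_surjective x
    obtain ⟨k, hk⟩ := ((h g).eventually (hN.mem_nhds N.one_mem)).exists
    refine (hm k).2 p ?_
    rw [← hx, orderOf_dvd_iff_pow_eq_one, ← QuotientGroup.mk_pow, QuotientGroup.eq_one_iff]
    exact hk

theorem Continuous.totallyDisconnectedSpace_of_injective {Y Z : Type*} [TopologicalSpace Y]
    [TopologicalSpace Z] [TotallyDisconnectedSpace Z] {f : Y → Z} (hf : Continuous f)
    (hinj : Function.Injective f) : TotallyDisconnectedSpace Y where
  isTotallyDisconnected_univ s _ hs :=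
    Set.subsingleton_of_image hinj s (hs.image f hf.continuousOn).subsingleton

theorem IsProPi.of_equiv {P : Set Nat.Primes} {G H : Type*} [Group G] [TopologicalSpace G]
    [IsTopologicalGroup G] [Group H] [TopologicalSpace H] [IsTopologicalGroup H] (e : G ≃ₜ* H)
    (hG : IsProPi P G) : IsProPi P H where
  compact := by
    have := hG.compact
    exact e.toHomeomorph.compactSpace
  t2 := by
    have := hG.t2
    exact e.toHomeomorph.t2Space
  totallyDisconnected := by
    have := hG.totallyDisconnected
    exact e.symm.continuous.totallyDisconnectedSpace_of_injective e.symm.injective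
  quotient N _ hN := by
    have h := hG.quotient (N.comap (e : G →* H)) (hN.preimage e.continuous)
    have hmap : (N.comap (e : G →* H)).map (e : G →* H) = N :=
      Subgroup.map_comap_eq_self_of_surjective e.surjective N
    let q : G ⧸ N.comap (e : G →* H) ≃* H ⧸ N := QuotientGroup.congr _ _ e.toMulEquiv hmap
    have := h.1
    exact ⟨Finite.of_equiv _ q.toEquiv, fun p hp => h.2 p (by rwa [Nat.card_congr q.toEquiv])⟩

/-- The identification of a topological group with its lift to a larger universe. -/
def continuousMulEquivULift.{x, z} (G : Type x) [Group G] [TopologicalSpace G] :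
    G ≃ₜ* ULift.{z} G where
  __ := MulEquiv.ulift.symm
  continuous_toFun := continuous_uliftUp
  continuous_invFun := continuous_uliftDown

/-- The universal property passes to smaller universes, by replacing the test group with its
`ULift`. -/
theorem IsFreeProPi.existsUnique_lift.{x, z} {P : Set Nat.Primes} {A : Type u} {S : Type v}
    [Group S] [TopologicalSpace S] [IsTopologicalGroup S] {ι : A → S}
    (hS : IsFreeProPi.{max x z} P ι) {G : Type x} [Group G] [TopologicalSpace G]
    [IsTopologicalGroup G] (hG : IsProPi P G) {φ : A → G} (hφ : ConvergesToOne φ) :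
    ∃! ψ : S →ₜ* G, ∀ a, ψ (ι a) = φ a := by
  let e : G ≃ₜ* ULift.{z} G := continuousMulEquivULift G
  obtain ⟨ψ, hψ, huniq⟩ := hS.lift (ULift.{z} G) (hG.of_equiv e) (fun a => e (φ a)) (by
    intro N _ hN
    exact hφ (N.comap (e : G →* ULift.{z} G)) inferInstance (hN.preimage e.continuous))
  refine ⟨(e.symm : ULift.{z} G →ₜ* G).comp ψ, fun a => ?_, fun ψ' hψ' => ?_⟩
  · change e.symm (ψ (ι a)) = φ a
    rw [hψ, e.symm_apply_apply]
  · have h := huniq ((e : G →ₜ* ULift.{z} G).comp ψ') (fun a => by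
      change e (ψ' (ι a)) = _
      rw [hψ'])
    ext σ
    rw [← h]
    exact (e.symm_apply_apply _).symm

theorem ConvergesToOne.of_finite {A G : Type*} [Group G] [TopologicalSpace G] {φ : A → G}
    (h : {a | φ a ≠ 1}.Finite) : ConvergesToOne φ :=
  fun N _ _ => h.subset fun _ ha h1 => ha (h1 ▸ N.one_mem)

/-- Continuous monoid homomorphisms that agree on topological generators agree. -/
theorem MonoidHom.eq_of_topologicalClosure_eq_top {S M A : Type*} [Group S] [TopologicalSpace S]
    [IsTopologicalGroup S] [Monoid M] [TopologicalSpace M] [T2Space M] {ι : A → S}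
    (hι : (Subgroup.closure (Set.range ι)).topologicalClosure = ⊤) {f g : S →* M}
    (hf : Continuous f) (hg : Continuous g) (h : ∀ a, f (ι a) = g (ι a)) : f = g := by
  have h1 : (Subgroup.closure (Set.range ι)).topologicalClosure ≤ f.eqLocus g := by
    refine Subgroup.topologicalClosure_minimal _ ?_ (isClosed_eq hf hg)
    rw [Subgroup.closure_le]
    rintro _ ⟨a, rfl⟩
    exact h a
  rw [hι] at h1
  ext σ
  exact h1 (Subgroup.mem_top σ)

/-- In a profinite group, a map that converges to `1` maps all but finitely many elements into any
given neighbourhood of `1`. -/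
theorem ConvergesToOne.finite_notMem {A G : Type*} [Group G] [TopologicalSpace G]
    [IsTopologicalGroup G] [CompactSpace G] [TotallyDisconnectedSpace G] {φ : A → G}
    (hφ : ConvergesToOne φ) {U : Set G} (hU : U ∈ 𝓝 1) : {a | φ a ∉ U}.Finite := by
  obtain ⟨V, hVU, hV, h1⟩ := mem_nhds_iff.1 hU
  obtain ⟨N, hN⟩ := ProfiniteGrp.exist_openNormalSubgroup_sub_open_nhds_of_one hV h1
  exact (hφ N.toSubgroup inferInstance N.isOpen').subset fun a ha h => ha (hVU (hN h))

/-! ## Binomial coefficients in `Ẑ_C` -/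

open Classical in
/-- A sequence of `Π`-numbers that converges to `0` in `Ẑ_C`. -/
noncomputable def piSeq (P : Set Nat.Primes) (k : ℕ) : ℕ :=
  ∏ p ∈ (Finset.range (k + 1)).filter (fun q => ∃ h : q.Prime, (⟨q, h⟩ : Nat.Primes) ∈ P), p ^ k

theorem isPiNumber_piSeq (P : Set Nat.Primes) (k : ℕ) : IsPiNumber P (piSeq P k) := by
  classical
  constructor
  · refine Finset.prod_ne_zero_iff.2 fun p hp => ?_
    obtain ⟨h, -⟩ := (Finset.mem_filter.1 hp).2
    exact pow_ne_zero _ h.ne_zero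
  · intro p hp
    obtain ⟨q, hq, hpq⟩ := (p.2.prime.dvd_finsetProd_iff _).1 hp
    obtain ⟨h, hqP⟩ := (Finset.mem_filter.1 hq).2
    have : (p : ℕ) = q := (Nat.prime_dvd_prime_iff_eq p.2 h).1 (p.2.dvd_of_dvd_pow hpq)
    have : p = ⟨q, h⟩ := Subtype.ext this
    rwa [this]

theorem pow_dvd_piSeq {P : Set Nat.Primes} {p : Nat.Primes} (hp : p ∈ P) {k : ℕ} (hk : (p : ℕ) ≤ k) :
    (p : ℕ) ^ k ∣ piSeq P k := by
  classical
  refine Finset.dvd_prod_of_mem (fun q => q ^ k) ?_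
  simp only [Finset.mem_filter, Finset.mem_range]
  exact ⟨by omega, p.2, hp⟩

/-- In $i!\binom{m}{i}=m(m-1)\cdots(m-i+1)$ the factor $m=m_k$ is divisible by $p^k$ as soon as
$k\ge p$. The fixed $i!$ costs only a constant in the $p$-adic norm. -/
theorem tendsto_choose_piSeq (P : Set Nat.Primes) {i : ℕ} (hi : i ≠ 0) :
    Tendsto (fun k => ((Nat.choose (piSeq P k) i : ℕ) : ZHatPi P)) atTop (𝓝 0) := by
  rw [tendsto_pi_nhds]
  intro p
  simp only [Pi.natCast_apply, Pi.zero_apply]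
  have hfac : ((i.factorial : ℕ) : ℤ_[((p : Nat.Primes) : ℕ)]) ≠ 0 :=
    Nat.cast_ne_zero.2 i.factorial_ne_zero
  have hp1 : (1 : ℝ) < ((p : Nat.Primes) : ℕ) := by exact_mod_cast p.1.2.one_lt
  have hlim : Tendsto (fun k : ℕ => ((((p : Nat.Primes) : ℕ) : ℝ)⁻¹ ^ k) *
      ‖((i.factorial : ℕ) : ℤ_[((p : Nat.Primes) : ℕ)])‖⁻¹) atTop (𝓝 0) := by
    have := tendsto_pow_atTop_nhds_zero_of_lt_one (r := (((p : Nat.Primes) : ℕ) : ℝ)⁻¹)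
      (by positivity) (inv_lt_one_of_one_lt₀ hp1)
    simpa using this.mul_const _
  refine squeeze_zero_norm' ?_ hlim
  filter_upwards [eventually_ge_atTop ((p : Nat.Primes) : ℕ)] with k hk
  rw [← div_eq_mul_inv, le_div_iff₀ (norm_pos_iff.2 hfac), ← norm_mul, ← Nat.cast_mul, mul_comm,
    ← Nat.descFactorial_eq_factorial_mul_choose]
  obtain ⟨i, rfl⟩ := Nat.exists_eq_succ_of_ne_zero hi
  have hdvd : ((p : Nat.Primes) : ℕ) ^ k ∣ (piSeq P k).descFactorial (i + 1) := by
    refine (pow_dvd_piSeq p.2 hk).trans ?_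
    rcases h : piSeq P k with _ | m
    · simp
    · rw [Nat.succ_descFactorial_succ]
      exact dvd_mul_right _ _
  have := (PadicInt.norm_int_le_pow_iff_dvd (p := ((p : Nat.Primes) : ℕ))
    (k := ((piSeq P k).descFactorial (i + 1) : ℕ)) (n := k)).2 (by exact_mod_cast hdvd)
  simpa [zpow_neg] using this

theorem tendsto_choose_piSeq_map {P : Set Nat.Primes} {R : Type*} [CommRing R] [TopologicalSpace R]
    {θ : ZHatPi P →+* R} (hθ : Continuous θ) {i : ℕ} (hi : i ≠ 0) :
    Tendsto (fun k => ((Nat.choose (piSeq P k) i : ℕ) : R)) atTop (𝓝 0) := by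
  have := (hθ.tendsto 0).comp (tendsto_choose_piSeq P hi)
  simpa [Function.comp_def] using this

/-- The binomial expansion as seen by `l`. The range of summation does not depend on the exponent,
so limits in `m` may be taken term by term. -/
theorem AddMonoidHom.map_one_add_pow {B C : Type*} [Ring B] [AddCommGroup C] (l : B →+ C) {x : B}
    {n : ℕ} (hx : ∀ i, n ≤ i → l (x ^ i) = 0) (m : ℕ) :
    l ((1 + x) ^ m) = ∑ i ∈ Finset.range n, m.choose i • l (x ^ i) := by
  have h : ∀ N, m + 1 ≤ N → l ((1 + x) ^ m) = ∑ i ∈ Finset.range N, m.choose i • l (x ^ i) := by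
    intro N hN
    rw [add_comm, (Commute.one_right x).add_pow, map_sum]
    refine Finset.sum_subset_zero_on_sdiff (by simpa using hN) (fun i hi => ?_) fun i hi => ?_
    · simp only [Finset.mem_sdiff, Finset.mem_range, not_lt] at hi
      rw [Nat.choose_eq_zero_of_lt (by omega), zero_smul]
    · rw [one_pow, mul_one, ← nsmul_eq_mul', map_nsmul]
  rw [h _ (le_max_left (m + 1) n)]
  refine (Finset.sum_subset_zero_on_sdiff (by simp) (fun i hi => ?_) fun i hi => rfl).symm
  simp only [Finset.mem_sdiff, Finset.mem_range, not_lt] at hi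
  rw [hx i hi.2, smul_zero]

/-- If `x` is nilpotent as seen by an additive map, then the powers of `1 + x` with `Π`-exponents
that converge to `0` converge to `1`. -/
theorem tendsto_map_one_add_pow {P : Set Nat.Primes} {R : Type*} [CommRing R] [TopologicalSpace R]
    [IsTopologicalRing R] {θ : ZHatPi P →+* R} (hθ : Continuous θ) {B : Type*} [Ring B]
    (l : B →+ R) {x : B} {n : ℕ} (hx : ∀ i, n ≤ i → l (x ^ i) = 0) :
    Tendsto (fun k => l ((1 + x) ^ piSeq P k)) atTop (𝓝 (l 1)) := by
  -- The bound is raised by one so that the term $i=0$, which supplies the limit, is always present.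
  have hx' : ∀ i, n + 1 ≤ i → l (x ^ i) = 0 := fun i hi => hx i (by omega)
  simp_rw [l.map_one_add_pow hx', nsmul_eq_mul]
  have : l 1 = ∑ i ∈ Finset.range (n + 1), (if i = 0 then 1 else 0) * l (x ^ i) := by
    rw [Finset.sum_range_succ']
    simp
  rw [this]
  refine tendsto_finsetSum _ fun i _ => Tendsto.mul_const _ ?_
  split_ifs with h
  · simpa [h] using tendsto_const_nhds
  · exact tendsto_choose_piSeq_map hθ h

/-! ## The Magnus algebra as a topological ring -/

namespace MagnusAlgebra

variable {R A : Type*}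

theorem continuous_coeff [TopologicalSpace R] (I : List A) :
    Continuous fun f : MagnusAlgebra R A => f I := continuous_apply (A := fun _ : List A => R) I

theorem continuous_of_coeff [TopologicalSpace R] {Z : Type*} [TopologicalSpace Z]
    {g : Z → MagnusAlgebra R A} (h : ∀ I, Continuous fun z => g z I) : Continuous g :=
  continuous_pi (A := fun _ : List A => R) h

instance [TopologicalSpace R] [T2Space R] : T2Space (MagnusAlgebra R A) :=
  inferInstanceAs (T2Space (List A → R))

instance [TopologicalSpace R] [CompactSpace R] : CompactSpace (MagnusAlgebra R A) :=
  inferInstanceAs (CompactSpace (List A → R))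

instance [TopologicalSpace R] [TotallyDisconnectedSpace R] :
    TotallyDisconnectedSpace (MagnusAlgebra R A) :=
  inferInstanceAs (TotallyDisconnectedSpace (List A → R))

variable [CommRing R]

/-- The coefficients of a power series, as additive maps. -/
def coeff (I : List A) : MagnusAlgebra R A →+ R where
  toFun f := f I
  map_zero' := rfl
  map_add' _ _ := rfl

theorem sub_apply (f g : MagnusAlgebra R A) (I : List A) : (f - g) I = f I - g I := rfl

theorem neg_apply (f : MagnusAlgebra R A) (I : List A) : (-f) I = -f I := rfl

instance [TopologicalSpace R] [IsTopologicalRing R] : IsTopologicalRing (MagnusAlgebra R A) where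
  continuous_add := continuous_of_coeff fun I =>
    ((continuous_coeff I).comp continuous_fst).add ((continuous_coeff I).comp continuous_snd)
  continuous_mul := continuous_of_coeff fun _ => continuous_finsetSum _ fun _ _ =>
    ((continuous_coeff _).comp continuous_fst).mul ((continuous_coeff _).comp continuous_snd)
  continuous_neg := continuous_of_coeff fun I => (continuous_coeff I).neg

@[simp] theorem one_nil : (1 : MagnusAlgebra R A) [] = 1 := rfl

@[simp] theorem one_cons (a : A) (I : List A) : (1 : MagnusAlgebra R A) (a :: I) = 0 := rfl

theorem mul_nil (f g : MagnusAlgebra R A) : (f * g) [] = f [] * g [] := by simp [mul_apply]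

@[simp] theorem X_nil (a : A) : (X a : MagnusAlgebra R A) [] = 0 := by simp [X]

theorem X_mul_nil (a : A) (f : MagnusAlgebra R A) : (X a * f : MagnusAlgebra R A) [] = 0 := by
  simp [mul_nil]

theorem X_mul_cons_self (a : A) (f : MagnusAlgebra R A) (I : List A) :
    (X a * f : MagnusAlgebra R A) (a :: I) = f I := by
  rw [mul_apply, Finset.sum_eq_single 1]
  · simp [X]
  · intro i _ hi
    rw [X, if_neg, zero_mul]
    intro h
    have := congrArg List.length h
    rcases i with _ | _ | i
    · simp at this
    · exact hi rfl
    · rcases I with _ | ⟨b, I⟩ <;> simp_all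
  · simp

theorem X_mul_cons_of_ne {a b : A} (h : b ≠ a) (f : MagnusAlgebra R A) (I : List A) :
    (X a * f : MagnusAlgebra R A) (b :: I) = 0 := by
  rw [mul_apply]
  refine Finset.sum_eq_zero fun i _ => ?_
  rw [X, if_neg, zero_mul]
  rcases i with _ | i
  · simp
  · simp [h]

/-- The monomial of a sequence. -/
noncomputable def monomial (I : List A) : MagnusAlgebra R A := (I.map X).prod

open Classical in
theorem monomial_apply (I J : List A) :
    (monomial I : MagnusAlgebra R A) J = if J = I then 1 else 0 := by
  induction I generalizing J with
  | nil => rcases J with _ | ⟨b, J⟩ <;> simp [monomial]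
  | cons a I ih =>
    rw [monomial, List.map_cons, List.prod_cons, ← monomial]
    rcases J with _ | ⟨b, J⟩
    · simp [X_mul_nil]
    · by_cases h : b = a
      · subst h
        simp [X_mul_cons_self, ih]
      · simp [X_mul_cons_of_ne h, h]

theorem monomial_append (I J : List A) :
    (monomial (I ++ J) : MagnusAlgebra R A) = monomial I * monomial J := by
  simp [monomial]

theorem monomial_nil : (monomial [] : MagnusAlgebra R A) = 1 := rfl

theorem monomial_singleton (a : A) : (monomial [a] : MagnusAlgebra R A) = X a := by
  simp [monomial]

theorem const_mul_comm (c : R) (f : MagnusAlgebra R A) : const c * f = f * const c := by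
  funext I
  rw [const_mul_apply, mul_const_apply, mul_comm]

theorem const_mul_const (c d : R) : (const c * const d : MagnusAlgebra R A) = const (c * d) := by
  funext I
  rw [const_mul_apply]
  rcases I with _ | ⟨a, I⟩
  · rfl
  · exact mul_zero _

theorem hasSum_monomial [TopologicalSpace R] (f : MagnusAlgebra R A) :
    HasSum (fun I => const (f I) * monomial I) f := by
  classical
  refine (Pi.hasSum (f := fun I => (const (f I) * monomial I : MagnusAlgebra R A))).2 fun J => ?_
  have : (fun I => (const (f I) * monomial I : MagnusAlgebra R A) J) =
      fun I => if I = J then f J else 0 := by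
    funext I
    rw [const_mul_apply, monomial_apply]
    split_ifs with h1 h2 h2
    · rw [h2, mul_one]
    · exact absurd h1.symm h2
    · exact absurd h2.symm h1
    · rw [mul_zero]
  rw [this]
  exact hasSum_ite_eq J (f J)

/-- A closed additive subgroup containing all multiples of monomials contains all power series. -/
theorem mem_of_isClosed [TopologicalSpace R] {K : AddSubgroup (MagnusAlgebra R A)}
    (hK : IsClosed (K : Set (MagnusAlgebra R A))) (h : ∀ (c : R) I, const c * monomial I ∈ K)
    (f : MagnusAlgebra R A) : f ∈ K :=
  hK.mem_of_tendsto (hasSum_monomial f) (Eventually.of_forall fun _ => K.sum_mem fun I _ => h _ I)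

/-- The coefficients of a right inverse of a power series with constant coefficient `1`. -/
def rightInvCoeff (f : List A → R) : List A → R
  | [] => 1
  | a :: I => -∑ i : Fin (I.length + 1),
      f ((a :: I).take (i + 1)) * rightInvCoeff f ((a :: I).drop (i + 1))
termination_by I => I.length
decreasing_by simp

/-- A right inverse of a power series with constant coefficient `1`. -/
def rightInv (f : MagnusAlgebra R A) : MagnusAlgebra R A := rightInvCoeff f

theorem rightInv_nil (f : MagnusAlgebra R A) : rightInv f [] = 1 :=
  rightInvCoeff.eq_1 f

theorem rightInv_cons (f : MagnusAlgebra R A) (a : A) (I : List A) :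
    rightInv f (a :: I) = -∑ i : Fin (I.length + 1),
      f ((a :: I).take (i + 1)) * rightInv f ((a :: I).drop (i + 1)) :=
  rightInvCoeff.eq_2 f a I

theorem mul_rightInv {f : MagnusAlgebra R A} (hf : f [] = 1) : f * rightInv f = 1 := by
  funext I
  rcases I with _ | ⟨a, I⟩
  · rw [mul_nil, hf, rightInv_nil, one_nil, one_mul]
  · rw [mul_apply, Finset.sum_range_succ', List.take_zero, List.drop_zero, hf, one_mul,
      rightInv_cons, one_cons, List.length_cons, Finset.sum_range]
    exact add_neg_cancel _

/-- A power series with constant coefficient `1`, as an element of the group of all such series. -/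
def toV (f : MagnusAlgebra R A) (hf : f [] = 1) : V R A :=
  ⟨⟨f, rightInv f, mul_rightInv hf, by
    -- The right inverse has a right inverse itself, which must be `f`; so the inverse is two-sided.
    have h1 := mul_rightInv hf
    have h2 := mul_rightInv (rightInv_nil f)
    have h3 : f = rightInv (rightInv f) := by
      calc f = f * (rightInv f * rightInv (rightInv f)) := by rw [h2, mul_one]
        _ = rightInv (rightInv f) := by rw [← mul_assoc, h1, one_mul]
    nth_rewrite 2 [h3]
    exact h2⟩, by
    ext
    exact hf⟩

theorem V_nil (g : V R A) : ((g : (MagnusAlgebra R A)ˣ) : MagnusAlgebra R A) [] = 1 :=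
  congrArg Units.val (MonoidHom.mem_ker.1 g.2)

theorem pow_apply_eq_zero {x : MagnusAlgebra R A} (hx : x [] = 0) {i : ℕ} {I : List A}
    (h : I.length < i) : (x ^ i) I = 0 := by
  induction i generalizing I with
  | zero => omega
  | succ i ih =>
    rw [pow_succ', mul_apply]
    refine Finset.sum_eq_zero fun j hj => ?_
    rcases j with _ | j
    · rw [List.take_zero, hx, zero_mul]
    · rw [ih (by simp only [List.length_drop]; simp at hj; omega), mul_zero]

theorem isClosed_V [TopologicalSpace R] [T2Space R] : IsClosed ((V R A : Subgroup (MagnusAlgebra R A)ˣ) :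
    Set (MagnusAlgebra R A)ˣ) := by
  have : ((V R A : Subgroup (MagnusAlgebra R A)ˣ) : Set (MagnusAlgebra R A)ˣ) =
      {u : (MagnusAlgebra R A)ˣ | (u : MagnusAlgebra R A) [] = 1} := by
    ext u
    exact ⟨fun h => V_nil ⟨u, h⟩, fun h => by
      refine MonoidHom.mem_ker.2 (Units.ext h)⟩
  rw [this]
  exact isClosed_eq ((continuous_coeff _).comp Units.continuous_val) continuous_const

end MagnusAlgebra

theorem Units.tendsto_one_of_val {M : Type*} [Monoid M] [TopologicalSpace M] {α : Type*}
    {l : Filter α} {g : α → Mˣ} (h1 : Tendsto (fun k => (g k : M)) l (𝓝 1))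
    (h2 : Tendsto (fun k => ((g k)⁻¹ : Mˣ).val) l (𝓝 1)) : Tendsto g l (𝓝 1) := by
  rw [Units.isInducing_embedProduct.tendsto_nhds_iff]
  exact h1.prodMk_nhds ((MulOpposite.continuous_op.tendsto _).comp h2)

theorem Units.totallyDisconnectedSpace {M : Type*} [Monoid M] [TopologicalSpace M]
    [TotallyDisconnectedSpace M] : TotallyDisconnectedSpace Mˣ :=
  Units.continuous_val.totallyDisconnectedSpace_of_injective Units.val_injective

/-! ### The pro-$\mathcal C$ group $V$ and change of coefficients -/

namespace MagnusAlgebra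

/-- With $g=1+x$, the power $x^i$ starts in degree $i$, so each coefficient of $g^m$ is a fixed
finite combination of binomial coefficients. Inverses are treated as well, since the units carry the
topology of pairs $(g,g^{-1})$. -/
theorem isProPi_V (P : Set Nat.Primes) (A : Type*) : IsProPi P (V (ZHatPi P) A) := by
  have : CompactSpace (V (ZHatPi P) A) := isCompact_iff_compactSpace.1 isClosed_V.isCompact
  have : TotallyDisconnectedSpace (MagnusAlgebra (ZHatPi P) A)ˣ := Units.totallyDisconnectedSpace
  refine isProPi_of_tendsto_pow (piSeq P) (isPiNumber_piSeq P) fun g => ?_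
  have key : ∀ g : V (ZHatPi P) A, Tendsto (fun k =>
      ((g : (MagnusAlgebra (ZHatPi P) A)ˣ) : MagnusAlgebra (ZHatPi P) A) ^ piSeq P k)
      atTop (𝓝 1) := by
    intro g
    refine tendsto_pi_nhds.2 fun I => ?_
    have := tendsto_map_one_add_pow (θ := RingHom.id (ZHatPi P)) continuous_id (coeff I)
      (x := ((g : (MagnusAlgebra (ZHatPi P) A)ˣ) : MagnusAlgebra (ZHatPi P) A) - 1)
      (n := I.length + 1) (fun i hi => pow_apply_eq_zero (by simp [sub_apply, V_nil]) (by omega))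
    rwa [add_sub_cancel] at this
  rw [tendsto_subtype_rng]
  refine Units.tendsto_one_of_val ?_ ?_
  · simpa using key g
  · simpa using key g⁻¹

theorem convergesToOne_of_X (P : Set Nat.Primes) {A : Type*} {φ : A → V (ZHatPi P) A}
    (h : ∀ a, ((φ a : (MagnusAlgebra (ZHatPi P) A)ˣ) : MagnusAlgebra (ZHatPi P) A) = 1 + X a) :
    ConvergesToOne φ := by
  classical
  have hcof : Tendsto φ cofinite (𝓝 1) := by
    have : CompactSpace (V (ZHatPi P) A) := (isProPi_V P A).compact
    let val : V (ZHatPi P) A → MagnusAlgebra (ZHatPi P) A := fun g =>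
      ((g : (MagnusAlgebra (ZHatPi P) A)ˣ) : MagnusAlgebra (ZHatPi P) A)
    have hval : Continuous val := Units.continuous_val.comp continuous_subtype_val
    -- By compactness of $V$, convergence of units can be tested on the coefficients of the series
    -- alone. Each coefficient involves at most one of the variables.
    have hemb := hval.isClosedEmbedding (fun a b h => Subtype.ext (Units.ext h))
    rw [hemb.isInducing.tendsto_nhds_iff]
    refine tendsto_pi_nhds.2 fun I => tendsto_const_nhds.congr' ?_
    have hfin : {a : A | I = [a]}.Finite := by
      refine Set.Subsingleton.finite fun a (ha : I = [a]) b (hb : I = [b]) => ?_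
      simpa using ha.symm.trans hb
    filter_upwards [hfin.compl_mem_cofinite] with a ha
    have ha : I ≠ [a] := ha
    have h2 : val (φ a) I = (1 : MagnusAlgebra (ZHatPi P) A) I + X a I := by
      simp only [val, h, add_apply]
    have h3 : (X a : MagnusAlgebra (ZHatPi P) A) I = 0 := if_neg ha
    exact ((h2.trans (by rw [h3, add_zero])).symm : _)
  intro N _ hN
  exact hcof.eventually (hN.mem_nhds N.one_mem)

/-- The ring homomorphism of Magnus algebras induced by a homomorphism of the coefficients. -/
def mapCoeff {R R' : Type*} [CommRing R] [CommRing R'] (A : Type*) (κ : R →+* R') :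
    MagnusAlgebra R A →+* MagnusAlgebra R' A where
  toFun f I := κ (f I)
  map_zero' := by funext I; exact map_zero κ
  map_one' := by
    funext I
    rcases I with _ | ⟨a, I⟩
    · exact map_one κ
    · exact map_zero κ
  map_add' f g := by funext I; exact map_add κ _ _
  map_mul' f g := by
    funext I
    change κ ((f * g) I) = ∑ i ∈ Finset.range (I.length + 1), κ (f (I.take i)) * κ (g (I.drop i))
    simp only [mul_apply, map_sum, map_mul]

theorem mapCoeff_X {R R' : Type*} [CommRing R] [CommRing R'] {A : Type*} (κ : R →+* R') (a : A) :
    mapCoeff A κ (X a) = X a := by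
  funext I
  change κ (X a I) = X a I
  simp only [X]
  split_ifs <;> simp

end MagnusAlgebra

/-! ## Profinite rings and matrices over them -/

section ProfiniteRing

variable {R : Type*} [CommRing R] [TopologicalSpace R] [IsTopologicalRing R] [CompactSpace R]

/-- The open ideals of a profinite ring form a basis of the neighbourhoods of `0`. -/
theorem exists_isOpen_ideal_subset [TotallyDisconnectedSpace R] {U : Set R}
    (hU : U ∈ 𝓝 0) : ∃ 𝔞 : Ideal R, IsOpen (𝔞 : Set R) ∧ (𝔞 : Set R) ⊆ U := by
  obtain ⟨V, hVU, hV, h0⟩ := mem_nhds_iff.1 hU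
  obtain ⟨H, hH⟩ := ProfiniteGrp.exist_openNormalAddSubgroup_sub_open_nhds_of_zero hV h0
  -- The largest ideal inside the open subgroup $H$. It is open because its complement is the
  -- projection of a closed set along the compact factor $R$.
  let 𝔞 : Ideal R :=
    { carrier := {r | ∀ s, s * r ∈ H}
      add_mem' := fun {a b} ha hb s => by rw [mul_add]; exact add_mem (ha s) (hb s)
      zero_mem' := fun s => by rw [mul_zero]; exact zero_mem H
      smul_mem' := fun c r hr s => by rw [smul_eq_mul, ← mul_assoc]; exact hr _ }
  refine ⟨𝔞, ?_, fun r hr => hVU (hH (by simpa using hr 1))⟩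
  have hcl : IsClosed {p : R × R | p.1 * p.2 ∉ (H : Set R)} :=
    (H.isOpen'.preimage (continuous_fst.mul continuous_snd)).isClosed_compl
  have : (𝔞 : Set R) = (Prod.snd '' {p : R × R | p.1 * p.2 ∉ (H : Set R)})ᶜ := by
    ext r
    refine ⟨?_, fun h s => ?_⟩
    · rintro h ⟨⟨s, r⟩, hp, rfl⟩
      exact hp (h s)
    · by_contra hs
      exact h ⟨(s, r), hs, rfl⟩
  rw [this]
  exact (isClosedMap_snd_of_compactSpace _ hcl).isOpen_compl

/-- Open ideals make the additive group nonarchimedean, and compactness makes it complete; there,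
terms tending to zero suffice for summability. -/
theorem summable_of_tendsto_cofinite_zero [TotallyDisconnectedSpace R] [T2Space R] {κ : Type*}
    {f : κ → R} (hf : ∀ 𝔞 : Ideal R, IsOpen (𝔞 : Set R) → {i | f i ∉ 𝔞}.Finite) : Summable f := by
  let : UniformSpace R := IsTopologicalAddGroup.rightUniformSpace R
  have : IsUniformAddGroup R := isUniformAddGroup_of_addCommGroup
  have : NonarchimedeanAddGroup R :=
    { is_nonarchimedean := fun U hU => by
        obtain ⟨𝔞, h1, h2⟩ := exists_isOpen_ideal_subset hU
        exact ⟨⟨𝔞.toAddSubgroup, h1⟩, h2⟩ }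
  refine NonarchimedeanAddGroup.summable_of_tendsto_cofinite_zero fun U hU => ?_
  obtain ⟨𝔞, h1, h2⟩ := exists_isOpen_ideal_subset hU
  exact (hf 𝔞 h1).subset fun i hi h => hi (h2 h)

variable [T2Space R]

theorem isClosed_idealJ (d : R) (t : ℕ) : IsClosed (idealJ d t : Set R) :=
  (Ideal.isCompact_of_fg ⟨{d ^ t}, by simp [idealJ]⟩).isClosed

omit [CompactSpace R] in
theorem isClosed_annihilator (𝔞 : Ideal R) : IsClosed (𝔞.annihilator : Set R) := by
  have : (𝔞.annihilator : Set R) = ⋂ s ∈ 𝔞, {r | r * s = 0} := by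
    ext r
    simp [Submodule.mem_annihilator]
  rw [this]
  exact isClosed_biInter fun s _ => isClosed_eq (continuous_mul_const s) continuous_const

omit [CompactSpace R] in
theorem isClosed_magnusL {R₀ : Type*} [CommRing R₀] [TopologicalSpace R₀] [T2Space R₀] (A : Type*)
    (n : ℕ) {θ : R₀ →+* R} (hθ : Continuous θ) (d : R) : IsClosed (magnusL A n θ d) := by
  have : magnusL A n θ d = {f : MagnusAlgebra R₀ A | f [] = 1} ∩
      ⋂ I : List A, ⋂ _ : 1 ≤ I.length, ⋂ _ : I.length < n,
        {f : MagnusAlgebra R₀ A | θ (f I) ∈ (idealJ d I.length).annihilator} := by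
    ext f
    simp [magnusL]
  rw [this]
  refine (isClosed_eq (MagnusAlgebra.continuous_coeff _) continuous_const).inter ?_
  exact isClosed_iInter fun I => isClosed_iInter fun _ => isClosed_iInter fun _ =>
    (isClosed_annihilator _).preimage (hθ.comp (MagnusAlgebra.continuous_coeff I))

theorem isClosed_triMat (n : ℕ) (d : R) (t : ℕ) : IsClosed (triMat n d t) := by
  have : triMat n d t = (⋂ i : Fin n, ⋂ j : Fin n, ⋂ _ : (j : ℤ) - (i : ℤ) ≤ (t : ℤ) - 1,
        {M : Matrix (Fin n) (Fin n) R | M i j = 0}) ∩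
      ⋂ i : Fin n, ⋂ j : Fin n, ⋂ _ : i ≤ j,
        {M : Matrix (Fin n) (Fin n) R | M i j ∈ (idealJ d ((j : ℕ) - (i : ℕ)) : Set R)} := by
    ext M
    simp [triMat]
  rw [this]
  refine IsClosed.inter ?_ ?_
  · exact isClosed_iInter fun i => isClosed_iInter fun j => isClosed_iInter fun _ =>
      isClosed_eq (continuous_id.matrix_elem i j) continuous_const
  · exact isClosed_iInter fun i => isClosed_iInter fun j => isClosed_iInter fun _ =>
      (isClosed_idealJ d _).preimage (continuous_id.matrix_elem i j)

theorem isClosed_unipJ (n : ℕ) (d : R) :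
    IsClosed (unipJ n d : Set (Matrix (Fin n) (Fin n) R)ˣ) := by
  have : (unipJ n d : Set (Matrix (Fin n) (Fin n) R)ˣ) = (fun u => u.val) ⁻¹' (triMat n d 0 ∩
      ⋂ i, {M : Matrix (Fin n) (Fin n) R | M i i = 1}) := by
    ext u
    simp only [Set.mem_preimage, Set.mem_inter_iff, Set.mem_iInter, Set.mem_ofPred_eq]
    rfl
  rw [this]
  refine IsClosed.preimage Units.continuous_val ((isClosed_triMat n d 0).inter ?_)
  exact isClosed_iInter fun i => isClosed_eq (continuous_id.matrix_elem i i) continuous_const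

omit [TopologicalSpace R] [IsTopologicalRing R] [CompactSpace R] [T2Space R] in
theorem sub_one_mem_triMat {n : ℕ} {d : R} (g : unipJ n d) :
    ((g : (Matrix (Fin n) (Fin n) R)ˣ) : Matrix (Fin n) (Fin n) R) - 1 ∈ triMat n d 1 := by
  have h0 := (triRing n d).sub_mem g.2.1 (triRing n d).one_mem
  refine ⟨fun i j h => ?_, h0.2⟩
  by_cases hij : i = j
  · subst hij
    rw [Matrix.sub_apply, Matrix.one_apply_eq, g.2.2, sub_self]
  · refine h0.1 i j ?_
    have : (i : ℕ) ≠ j := fun h => hij (Fin.ext h)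
    push_cast at h ⊢
    omega

omit [TopologicalSpace R] [IsTopologicalRing R] [CompactSpace R] [T2Space R] in
theorem triMat_eq_zero {n t : ℕ} (h : n ≤ t) {d : R} {M : Matrix (Fin n) (Fin n) R}
    (hM : M ∈ triMat n d t) : M = 0 := by
  ext i j
  exact hM.1 i j (by have := i.2; have := j.2; omega)

/-- Since $(g-1)^n=0$, the entries of $g^m$ are combinations of $\binom{m}{i}$ with $i<n$, and
$\theta$ carries the limits of these from $\hat{\mathbb Z}_{\mathcal C}$ to $R$. -/
theorem isProPi_unipJ [TotallyDisconnectedSpace R] {P : Set Nat.Primes} {θ : ZHatPi P →+* R}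
    (hθ : Continuous θ) (n : ℕ) (d : R) : IsProPi P (unipJ n d) := by
  have : CompactSpace (Matrix (Fin n) (Fin n) R) :=
    inferInstanceAs (CompactSpace (Fin n → Fin n → R))
  have : TotallyDisconnectedSpace (Matrix (Fin n) (Fin n) R) :=
    inferInstanceAs (TotallyDisconnectedSpace (Fin n → Fin n → R))
  have : TotallyDisconnectedSpace (Matrix (Fin n) (Fin n) R)ˣ := Units.totallyDisconnectedSpace
  have : CompactSpace (unipJ n d) := isCompact_iff_compactSpace.1 (isClosed_unipJ n d).isCompact
  refine isProPi_of_tendsto_pow (piSeq P) (isPiNumber_piSeq P) fun g => ?_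
  have key : ∀ g : unipJ n d, Tendsto (fun k =>
      ((g : (Matrix (Fin n) (Fin n) R)ˣ) : Matrix (Fin n) (Fin n) R) ^ piSeq P k)
      atTop (𝓝 1) := by
    intro g
    refine tendsto_pi_nhds.2 fun i => tendsto_pi_nhds.2 fun j => ?_
    have := tendsto_map_one_add_pow hθ (Matrix.entryAddMonoidHom R i j)
      (x := ((g : (Matrix (Fin n) (Fin n) R)ˣ) : Matrix (Fin n) (Fin n) R) - 1)
      (n := n) (fun t ht => by
        rw [triMat_eq_zero ht (triMat_pow (sub_one_mem_triMat g) t), map_zero])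
    rwa [add_sub_cancel] at this
  rw [tendsto_subtype_rng]
  refine Units.tendsto_one_of_val ?_ ?_
  · simpa using key g
  · simpa using key g⁻¹

end ProfiniteRing

theorem finite_lists_of_finite {A : Type*} {s : Set A} (hs : s.Finite) (n : ℕ) :
    {I : List A | I.length < n ∧ ∀ a ∈ I, a ∈ s}.Finite := by
  have := hs.to_subtype
  refine ((List.finite_length_lt s n).image (List.map Subtype.val)).subset ?_
  rintro I ⟨hI, h⟩
  lift I to List s using h
  exact ⟨I, by simpa using hI, rfl⟩

/-! ## The evaluation of power series at unipotent matrices -/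

section Evaluation

variable {R : Type*} [CommRing R] {A : Type*} {n : ℕ} {d : R} (x : A → unipJ n d)

theorem monomialMat_cons (a : A) (I : List A) : monomialMat x (a :: I) =
    (((x a : (Matrix (Fin n) (Fin n) R)ˣ) : Matrix (Fin n) (Fin n) R) - 1) * monomialMat x I := by
  simp [monomialMat]

theorem monomialMat_append (I J : List A) :
    monomialMat x (I ++ J) = monomialMat x I * monomialMat x J := by
  simp [monomialMat]

theorem monomialMat_mem (I : List A) : monomialMat x I ∈ triMat n d I.length := by
  induction I with
  | nil => exact (triRing n d).one_mem
  | cons a I ih =>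
    rw [monomialMat_cons, List.length_cons, add_comm]
    exact triMat_mul (sub_one_mem_triMat _) ih

theorem triMat_anti {s t : ℕ} (h : s ≤ t) : triMat n d t ⊆ triMat n d s :=
  fun _ hM => ⟨fun i j hij => hM.1 i j (by omega), hM.2⟩

theorem monomialMat_mem_ideal {𝔞 : Ideal R} {I : List A}
    (h : ∃ a ∈ I, ∀ i j, (((x a : (Matrix (Fin n) (Fin n) R)ˣ) :
      Matrix (Fin n) (Fin n) R) - 1) i j ∈ 𝔞) (i j : Fin n) : monomialMat x I i j ∈ 𝔞 := by
  induction I generalizing i with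
  | nil => simp at h
  | cons b I ih =>
    rw [monomialMat_cons, Matrix.mul_apply]
    refine 𝔞.sum_mem fun k _ => ?_
    obtain ⟨a, ha, h⟩ := h
    rcases List.mem_cons.1 ha with rfl | ha
    · exact 𝔞.mul_mem_right _ (h i k)
    · exact 𝔞.mul_mem_left _ (ih ⟨a, ha, h⟩ k)

variable [TopologicalSpace R] [IsTopologicalRing R] [CompactSpace R] [T2Space R]
  [TotallyDisconnectedSpace R]

variable {x}

omit [CompactSpace R] [T2Space R] [TotallyDisconnectedSpace R] in
-- Modulo an open ideal all but finitely many $x(a)$ are $1$. A word with a nonzero entry uses only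
-- the exceptional letters, and only lengths below $n$ are considered.
theorem finite_monomialMat_notMem (hx : Tendsto x cofinite (𝓝 1)) {𝔞 : Ideal R}
    (h𝔞 : IsOpen (𝔞 : Set R)) (i j : Fin n) :
    {I : {I : List A // I.length < n} | monomialMat x I.1 i j ∉ 𝔞}.Finite := by
  have h1 : {a | ¬ ∀ i j, (((x a : (Matrix (Fin n) (Fin n) R)ˣ) :
      Matrix (Fin n) (Fin n) R) - 1) i j ∈ 𝔞}.Finite := by
    refine hx.eventually (p := fun g : unipJ n d => ∀ i j,
      (((g : (Matrix (Fin n) (Fin n) R)ˣ) : Matrix (Fin n) (Fin n) R) - 1) i j ∈ 𝔞) ?_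
    refine eventually_all.2 fun i => eventually_all.2 fun j => ?_
    have hc : Continuous fun g : unipJ n d =>
        (((g : (Matrix (Fin n) (Fin n) R)ˣ) : Matrix (Fin n) (Fin n) R) - 1) i j :=
      ((Units.continuous_val.comp continuous_subtype_val).sub continuous_const).matrix_elem i j
    exact hc.continuousAt.eventually (h𝔞.mem_nhds (by simp))
  refine Set.Finite.of_finite_image (f := Subtype.val) ((finite_lists_of_finite h1 n).subset ?_)
    Subtype.val_injective.injOn
  rintro _ ⟨I, hI, rfl⟩
  refine ⟨I.2, fun a ha h => hI ?_⟩
  exact monomialMat_mem_ideal x ⟨a, ha, h⟩ i j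

variable {R₀ : Type*} [CommRing R₀] (θ : R₀ →+* R)

theorem summable_eval (hx : Tendsto x cofinite (𝓝 1)) (f : MagnusAlgebra R₀ A) :
    Summable fun I : {I : List A // I.length < n} => θ (f I.1) • monomialMat x I.1 := by
  refine Pi.summable.2 fun i => Pi.summable.2 fun j => ?_
  refine summable_of_tendsto_cofinite_zero fun 𝔞 h𝔞 => ?_
  exact (finite_monomialMat_notMem hx h𝔞 i j).subset fun I hI h => hI (𝔞.mul_mem_left _ h)

/-- The evaluation of power series at a family of unipotent matrices converging to `1`, as an
additive map. -/
noncomputable def evalAdd (hx : Tendsto x cofinite (𝓝 1)) :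
    MagnusAlgebra R₀ A →+ Matrix (Fin n) (Fin n) R where
  toFun f := ∑' I : {I : List A // I.length < n}, θ (f I.1) • monomialMat x I.1
  map_zero' := by simp [MagnusAlgebra.zero_apply]
  map_add' f g := by
    rw [← (summable_eval θ hx f).tsum_add (summable_eval θ hx g)]
    simp [MagnusAlgebra.add_apply, add_smul]

theorem hasSum_evalAdd (hx : Tendsto x cofinite (𝓝 1)) (f : MagnusAlgebra R₀ A) :
    HasSum (fun I : {I : List A // I.length < n} => θ (f I.1) • monomialMat x I.1)
      (evalAdd θ hx f) :=
  (summable_eval θ hx f).hasSum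

theorem evalAdd_mem (hx : Tendsto x cofinite (𝓝 1)) (f : MagnusAlgebra R₀ A) :
    evalAdd θ hx f ∈ triMat n d 0 := by
  refine (isClosed_triMat n d 0).mem_of_tendsto (hasSum_evalAdd θ hx f)
    (Eventually.of_forall fun s => ?_)
  refine (triRing n d).sum_mem fun I _ => ?_
  have h := triMat_anti (Nat.zero_le _) (monomialMat_mem x I.1)
  refine ⟨fun i j hij => ?_, fun i j hij => ?_⟩
  · rw [Matrix.smul_apply, h.1 i j hij, smul_zero]
  · exact Ideal.mul_mem_left _ _ (h.2 i j hij)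

variable {θ}

/-- Modulo an open ideal, the value depends on finitely many coefficients only. -/
theorem continuous_evalAdd [TopologicalSpace R₀] [IsTopologicalRing R₀] (hθ : Continuous θ)
    (hx : Tendsto x cofinite (𝓝 1)) :
    Continuous (evalAdd θ hx : MagnusAlgebra R₀ A → Matrix (Fin n) (Fin n) R) := by
  refine continuous_of_continuousAt_zero _ ?_
  rw [ContinuousAt, map_zero]
  refine tendsto_pi_nhds.2 fun i => tendsto_pi_nhds.2 fun j => ?_
  intro U hU
  obtain ⟨𝔞, h𝔞, hU⟩ := exists_isOpen_ideal_subset hU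
  have hcl : IsClosed (𝔞 : Set R) := AddSubgroup.isClosed_of_isOpen 𝔞.toAddSubgroup h𝔞
  have hfin := finite_monomialMat_notMem hx h𝔞 i j
  have h1 : ∀ᶠ f in 𝓝 (0 : MagnusAlgebra R₀ A), ∀ I ∈ hfin.toFinset, θ (f I.1) ∈ 𝔞 := by
    refine (eventually_all_finset _).2 fun I _ => ?_
    exact (hθ.comp (MagnusAlgebra.continuous_coeff I.1)).continuousAt.eventually
      (h𝔞.mem_nhds (by simp [MagnusAlgebra.zero_apply]))
  refine mem_map.2 ?_
  filter_upwards [h1] with f hf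
  refine hU (hcl.mem_of_tendsto
    ((hasSum_evalAdd θ hx f).map (Matrix.entryAddMonoidHom R i j) (continuous_id.matrix_elem i j))
    (Eventually.of_forall fun s => 𝔞.sum_mem fun I _ => ?_))
  change θ (f I.1) * monomialMat x I.1 i j ∈ 𝔞
  by_cases h : monomialMat x I.1 i j ∈ 𝔞
  · exact 𝔞.mul_mem_left _ h
  · exact 𝔞.mul_mem_right _ (hf I (by simpa using h))

theorem evalAdd_monomial (hx : Tendsto x cofinite (𝓝 1)) (c : R₀) (I : List A) :
    evalAdd θ hx (MagnusAlgebra.const c * MagnusAlgebra.monomial I) = θ c • monomialMat x I := by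
  classical
  have h := hasSum_evalAdd θ hx (MagnusAlgebra.const c * MagnusAlgebra.monomial I)
  by_cases hI : I.length < n
  · refine h.unique ?_
    convert hasSum_single (⟨I, hI⟩ : {I : List A // I.length < n}) ?_ using 1
    · simp [MagnusAlgebra.const_mul_apply, MagnusAlgebra.monomial_apply]
    · rintro ⟨J, hJ⟩ hne
      have : J ≠ I := fun h => hne (Subtype.ext h)
      simp [MagnusAlgebra.const_mul_apply, MagnusAlgebra.monomial_apply, this]
  · rw [triMat_eq_zero (not_lt.1 hI) (monomialMat_mem x I), smul_zero]
    refine h.unique ?_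
    convert hasSum_zero using 1
    funext ⟨J, hJ⟩
    have : J ≠ I := fun h => hI (h ▸ hJ)
    simp [MagnusAlgebra.const_mul_apply, MagnusAlgebra.monomial_apply, this]

theorem evalAdd_const (hx : Tendsto x cofinite (𝓝 1)) (c : R₀) :
    evalAdd θ hx (MagnusAlgebra.const c) = θ c • (1 : Matrix (Fin n) (Fin n) R) := by
  have := evalAdd_monomial (θ := θ) hx c []
  rwa [MagnusAlgebra.monomial_nil, mul_one] at this

theorem evalAdd_one_add_X (hx : Tendsto x cofinite (𝓝 1)) (a : A) :
    evalAdd θ hx (1 + MagnusAlgebra.X a) =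
      ((x a : (Matrix (Fin n) (Fin n) R)ˣ) : Matrix (Fin n) (Fin n) R) := by
  have h1 := evalAdd_monomial (θ := θ) hx 1 []
  have h2 := evalAdd_monomial (θ := θ) hx 1 [a]
  rw [show (MagnusAlgebra.const 1 : MagnusAlgebra R₀ A) = 1 from rfl, one_mul, map_one,
    one_smul] at h1 h2
  rw [MagnusAlgebra.monomial_nil] at h1
  rw [MagnusAlgebra.monomial_singleton] at h2
  rw [map_add, h1, h2]
  simp [monomialMat]

variable [TopologicalSpace R₀] [IsTopologicalRing R₀]

/-- Both sides are biadditive and separately continuous, so multiples of monomials suffice: `L`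
reduces the first factor to them, then `K` the second. -/
theorem evalAdd_mul (hθ : Continuous θ) (hx : Tendsto x cofinite (𝓝 1))
    (f g : MagnusAlgebra R₀ A) : evalAdd θ hx (f * g) = evalAdd θ hx f * evalAdd θ hx g := by
  have hc := continuous_evalAdd hθ hx
  let K (f : MagnusAlgebra R₀ A) : AddSubgroup (MagnusAlgebra R₀ A) :=
    { carrier := {g | evalAdd θ hx (f * g) = evalAdd θ hx f * evalAdd θ hx g}
      add_mem' := fun {g h} hg hh => by
        simp only [Set.mem_ofPred_eq, mul_add, map_add] at *
        rw [hg, hh]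
      zero_mem' := by simp
      neg_mem' := fun {g} hg => by
        simp only [Set.mem_ofPred_eq, mul_neg, map_neg] at *
        rw [hg] }
  let L : AddSubgroup (MagnusAlgebra R₀ A) :=
    { carrier := {f | ∀ g, evalAdd θ hx (f * g) = evalAdd θ hx f * evalAdd θ hx g}
      add_mem' := fun {f h} hf hh g => by
        rw [add_mul, map_add, map_add, add_mul, hf g, hh g]
      zero_mem' := by simp
      neg_mem' := fun {f} hf g => by
        rw [neg_mul, map_neg, map_neg, neg_mul, hf g] }
  refine MagnusAlgebra.mem_of_isClosed (K := L) ?_ (fun c I g => ?_) f g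
  · have : (L : Set (MagnusAlgebra R₀ A)) =
        ⋂ g, {f | evalAdd θ hx (f * g) = evalAdd θ hx f * evalAdd θ hx g} := by
      ext f
      simp [L]
    rw [this]
    exact isClosed_iInter fun g => isClosed_eq (hc.comp (continuous_mul_const g))
      (hc.mul continuous_const)
  · refine MagnusAlgebra.mem_of_isClosed (K := K (MagnusAlgebra.const c *
      MagnusAlgebra.monomial I)) ?_ (fun c' J => ?_) g
    · exact isClosed_eq (hc.comp (continuous_const_mul _)) (continuous_const.mul hc)
    · change evalAdd θ hx _ = evalAdd θ hx _ * evalAdd θ hx _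
      have : (MagnusAlgebra.const c * MagnusAlgebra.monomial I *
          (MagnusAlgebra.const c' * MagnusAlgebra.monomial J) : MagnusAlgebra R₀ A) =
          MagnusAlgebra.const (c * c') * MagnusAlgebra.monomial (I ++ J) := by
        rw [mul_assoc, ← mul_assoc (MagnusAlgebra.monomial I), ← MagnusAlgebra.const_mul_comm,
          MagnusAlgebra.monomial_append, ← MagnusAlgebra.const_mul_const]
        simp only [mul_assoc]
      rw [this, evalAdd_monomial, evalAdd_monomial, evalAdd_monomial, monomialMat_append, map_mul,
        smul_mul_smul_comm]

/-- The evaluation of power series at a family of unipotent matrices converging to `1`. -/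
noncomputable def evalHom (hθ : Continuous θ) (hx : Tendsto x cofinite (𝓝 1)) :
    MagnusAlgebra R₀ A →+* triRing n d where
  toFun f := ⟨evalAdd θ hx f, evalAdd_mem θ hx f⟩
  map_zero' := Subtype.ext (map_zero _)
  map_add' f g := Subtype.ext (map_add _ _ _)
  map_one' := Subtype.ext (by
    have := evalAdd_const (θ := θ) hx 1
    rw [map_one, one_smul] at this
    exact this)
  map_mul' f g := Subtype.ext (evalAdd_mul hθ hx f g)

theorem continuous_evalHom (hθ : Continuous θ) (hx : Tendsto x cofinite (𝓝 1)) :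
    Continuous (evalHom (R₀ := R₀) hθ hx) :=
  (continuous_evalAdd hθ hx).subtype_mk _

end Evaluation

/-- Continuous ring homomorphisms on the Magnus algebra that agree on constants and variables
agree. -/
theorem MagnusAlgebra.ringHom_ext {R₀ A T : Type*} [CommRing R₀] [TopologicalSpace R₀] [Ring T]
    [TopologicalSpace T] [T2Space T] {f g : MagnusAlgebra R₀ A →+* T} (hf : Continuous f)
    (hg : Continuous g) (hc : ∀ c, f (const c) = g (const c)) (hX : ∀ a, f (X a) = g (X a)) :
    f = g := by
  let K : AddSubgroup (MagnusAlgebra R₀ A) := (f : MagnusAlgebra R₀ A →+ T).eqLocus g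
  ext1 h
  refine mem_of_isClosed (K := K) (isClosed_eq hf hg) (fun c I => ?_) h
  change f _ = g _
  rw [map_mul, map_mul, hc]
  congr 1
  induction I with
  | nil => rw [monomial_nil, map_one, map_one]
  | cons a I ih =>
    rw [← List.singleton_append, monomial_append, monomial_singleton, map_mul, map_mul, ih, hX]

/-! ## The intersection of the kernels of the unipotent representations -/

section TestRepresentation

variable {R : Type*} [CommRing R] {A : Type*} {n : ℕ} {d : R}

/-- The unipotent matrix `1 + N` for a strictly upper triangular matrix `N`. -/
noncomputable def unipOfTriMat {N : Matrix (Fin n) (Fin n) R} (hN : N ∈ triMat n d 1) :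
    unipJ n d :=
  ⟨(IsNilpotent.isUnit_one_add ⟨n, triMat_eq_zero le_rfl (triMat_pow hN n)⟩ : IsUnit (1 + N)).unit,
    (triRing n d).add_mem (triRing n d).one_mem (triMat_anti (Nat.zero_le _) hN), fun i => by
      rw [IsUnit.unit_spec, Matrix.add_apply, Matrix.one_apply_eq, hN.1 i i (by simp), add_zero]⟩

theorem coe_unipOfTriMat {N : Matrix (Fin n) (Fin n) R} (hN : N ∈ triMat n d 1) :
    ((unipOfTriMat hN : (Matrix (Fin n) (Fin n) R)ˣ) : Matrix (Fin n) (Fin n) R) = 1 + N := rfl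

variable (n d)

open Classical in
/-- The matrix with entries `d` at those places `(i, i + 1)` for which `a` is the `i`-th term of a
given sequence. -/
noncomputable def seqMat (I : List A) (a : A) : Matrix (Fin n) (Fin n) R :=
  fun i j => if (j : ℕ) = i + 1 ∧ I[(i : ℕ)]? = some a then d else 0

theorem seqMat_mem (I : List A) (a : A) : seqMat n d I a ∈ triMat n d 1 := by
  refine ⟨fun i j h => if_neg fun h' => ?_, fun i j _ => ?_⟩
  · have := h'.1
    push_cast at h
    omega
  · rw [seqMat]
    split_ifs with h
    · rw [h.1, add_tsub_cancel_left, idealJ, pow_one]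
      exact Ideal.mem_span_singleton_self d
    · exact Ideal.zero_mem _

/-- The unipotent matrices of the test representation attached to a sequence. -/
noncomputable def seqUnip (I : List A) (a : A) : unipJ n d := unipOfTriMat (seqMat_mem n d I a)

theorem List.cons_prefix_drop_iff (I : List A) (b : A) (K : List A) (i : ℕ) :
    b :: K <+: I.drop i ↔ I[i]? = some b ∧ K <+: I.drop (i + 1) := by
  rcases lt_or_ge i I.length with h | h
  · rw [List.drop_eq_getElem_cons h, List.cons_prefix_cons, List.getElem?_eq_getElem h,
      Option.some_inj, eq_comm]
  · rw [List.drop_eq_nil_of_le h, List.getElem?_eq_none h]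
    simp

open Classical in
-- Each letter moves one step along the superdiagonal, and a step at place $i$ is allowed only if
-- the letter is the $i$-th term of $I$. A product of letters thus survives exactly where it is
-- spelled in $I$ from position $i$ on.
theorem monomialMat_seqUnip (I K : List A) (i j : Fin n) :
    monomialMat (seqUnip n d I) K i j =
      if (j : ℕ) = i + K.length ∧ K <+: I.drop i then d ^ K.length else 0 := by
  induction K generalizing i with
  | nil =>
    by_cases h : i = j
    · subst h
      simp [monomialMat]
    · have h' : (j : ℕ) ≠ i := fun h' => h (Fin.ext h'.symm)
      simp [monomialMat, Matrix.one_apply_ne h, h']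
  | cons b K ih =>
    rw [monomialMat_cons, seqUnip, coe_unipOfTriMat, add_sub_cancel_left, Matrix.mul_apply]
    rcases lt_or_ge ((i : ℕ) + 1) n with hi | hi
    · rw [Finset.sum_eq_single ⟨(i : ℕ) + 1, hi⟩, ih, seqMat]
      · simp only [true_and, List.length_cons, List.cons_prefix_drop_iff]
        by_cases h1 : I[(i : ℕ)]? = some b
        · by_cases h2 : (j : ℕ) = i + 1 + K.length ∧ K <+: I.drop (i + 1)
          · rw [if_pos h1, if_pos h2, if_pos ⟨by omega, h1, h2.2⟩, pow_succ']
          · rw [if_neg h2, mul_zero, if_neg]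
            rintro ⟨h3, -, h4⟩
            exact h2 ⟨by omega, h4⟩
        · rw [if_neg h1, zero_mul, if_neg]
          rintro ⟨-, h2, -⟩
          exact h1 h2
      · intro k _ hk
        rw [seqMat, if_neg fun h => hk (Fin.ext h.1), zero_mul]
      · simp
    · rw [if_neg fun h => by have := j.2; have := h.1; simp at this; omega]
      refine Finset.sum_eq_zero fun k _ => ?_
      rw [seqMat, if_neg fun h => by have := k.2; have := h.1; omega, zero_mul]

theorem finite_seqUnip_ne_one (I : List A) : {a | seqUnip n d I a ≠ 1}.Finite := by
  refine I.finite_toSet.subset fun a ha => ?_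
  by_contra h
  refine ha (Subtype.ext (Units.ext ?_))
  rw [seqUnip, coe_unipOfTriMat]
  have : seqMat n d I a = 0 := by
    ext i j
    refine if_neg fun h' => h ?_
    exact List.mem_of_getElem? h'.2
  rw [this, add_zero]
  rfl

theorem idealJ_anti {s t : ℕ} (d : R) (h : s ≤ t) : idealJ d t ≤ idealJ d s :=
  Ideal.span_singleton_le_span_singleton.2 (pow_dvd_pow d h)

variable {n d} in
-- The entries of $M_I$ vanish unless $j-i\ge|I|$, and then they lie in $J_{j-i}\subseteq J_{|I|}$.
theorem smul_monomialMat_eq_zero {x : A → unipJ n d} {I : List A} {c : R}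
    (hc : c ∈ (idealJ d I.length).annihilator) : c • monomialMat x I = 0 := by
  ext i j
  have h := monomialMat_mem x I
  rw [Matrix.smul_apply]
  by_cases hij : (j : ℤ) - (i : ℤ) ≤ (I.length : ℤ) - 1
  · rw [h.1 i j hij, smul_zero, Matrix.zero_apply]
  · exact Submodule.mem_annihilator.1 hc _ (idealJ_anti d (by omega) (h.2 i j (by
      rw [Fin.le_def]; omega)))

end TestRepresentation

/-- The Magnus homomorphism, with values in the Magnus algebra. -/
noncomputable def magnusVal {P : Set Nat.Primes} {A S : Type*} [Group S] [TopologicalSpace S]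
    (Λ : S →ₜ* MagnusAlgebra.V (ZHatPi P) A) : S →* MagnusAlgebra (ZHatPi P) A :=
  (Units.coeHom _).comp ((MagnusAlgebra.V (ZHatPi P) A).subtype.comp (Λ : S →* _))

theorem continuous_magnusVal {P : Set Nat.Primes} {A S : Type*} [Group S] [TopologicalSpace S]
    (Λ : S →ₜ* MagnusAlgebra.V (ZHatPi P) A) : Continuous (magnusVal Λ) :=
  Units.continuous_val.comp (continuous_subtype_val.comp Λ.continuous_toFun)

section MagnusHom

variable {P : Set Nat.Primes} {A : Type u} {S : Type v} [Group S] [TopologicalSpace S]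
  [IsTopologicalGroup S] {ι : A → S} {Λ : S →ₜ* MagnusAlgebra.V (ZHatPi P) A}
  {R : Type w} [CommRing R] [TopologicalSpace R] [IsTopologicalRing R] [CompactSpace R]
  [T2Space R] [TotallyDisconnectedSpace R] {θ : ZHatPi P →+* R} {n : ℕ} {d : R}

theorem ConvergesToOne.comp_tendsto [CompactSpace S] [TotallyDisconnectedSpace S]
    (hι : ConvergesToOne ι) {G : Type*} [Group G] [TopologicalSpace G] (φ : S →ₜ* G) :
    Tendsto (fun a => φ (ι a)) cofinite (𝓝 1) := by
  intro U hU
  have : φ ⁻¹' U ∈ 𝓝 (1 : S) := φ.continuous_toFun.continuousAt.preimage_mem_nhds (by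
    change U ∈ 𝓝 (φ 1)
    rwa [map_one])
  exact hι.finite_notMem this

theorem evalHom_magnusVal (hgen : (Subgroup.closure (Set.range ι)).topologicalClosure = ⊤)
    (hΛ : ∀ a, magnusVal Λ (ι a) = 1 + MagnusAlgebra.X a) (hθ : Continuous θ)
    {φ : S →ₜ* unipJ n d} (hx : Tendsto (fun a => φ (ι a)) cofinite (𝓝 1)) (σ : S) :
    evalAdd θ hx (magnusVal Λ σ) =
      ((φ σ : (Matrix (Fin n) (Fin n) R)ˣ) : Matrix (Fin n) (Fin n) R) := by
  let f : S →* Matrix (Fin n) (Fin n) R :=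
    ((triRing n d).subtype : triRing n d →* Matrix (Fin n) (Fin n) R).comp
      ((evalHom hθ hx : MagnusAlgebra (ZHatPi P) A →* triRing n d).comp (magnusVal Λ))
  let g : S →* Matrix (Fin n) (Fin n) R :=
    (Units.coeHom _).comp ((unipJ n d).subtype.comp (φ : S →* _))
  have : f = g := by
    refine MonoidHom.eq_of_topologicalClosure_eq_top hgen (f := f) (g := g) ?_ ?_ fun a => ?_
    · exact (continuous_evalAdd hθ hx).comp (continuous_magnusVal Λ)
    · exact Units.continuous_val.comp (continuous_subtype_val.comp φ.continuous_toFun)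
    · change evalAdd θ hx (magnusVal Λ (ι a)) = _
      rw [hΛ, evalAdd_one_add_X]
      rfl
  exact DFunLike.congr_fun this σ

theorem mem_kerIntCont {H G : Type*} [Group H] [TopologicalSpace H] [Group G] [TopologicalSpace G]
    {σ : H} : σ ∈ kerIntCont H G ↔ ∀ φ : H →ₜ* G, φ σ = 1 := by
  simp only [kerIntCont, Subgroup.mem_iInf, MonoidHom.mem_ker]
  rfl

variable (Λ) in
-- The expansion $\varphi(\sigma)=\sum_{|K|<n}\theta(c_K)M_K$ serves both directions: the test
-- representation of $I$ isolates $\theta(c_I)d^{|I|}$, and conversely all terms with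
-- $K\ne\emptyset$ vanish.
theorem mem_kerIntCont_iff (hS : IsFreeProPi.{max w y} P ι)
    (hΛ : ∀ a, magnusVal Λ (ι a) = 1 + MagnusAlgebra.X a) (hθ : Continuous θ) (n : ℕ) (d : R)
    (σ : S) : σ ∈ kerIntCont S (unipJ n d) ↔ magnusVal Λ σ ∈ magnusL A n θ d := by
  have := hS.isProPi.compact
  have := hS.isProPi.totallyDisconnected
  rw [mem_kerIntCont]
  constructor
  · intro h
    refine ⟨MagnusAlgebra.V_nil (Λ σ), fun I h1 hn => ?_⟩
    obtain ⟨φ, hφ, -⟩ := IsFreeProPi.existsUnique_lift.{u, v, w, y} hS (isProPi_unipJ hθ n d)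
      (ConvergesToOne.of_finite (finite_seqUnip_ne_one n d I))
    have hx := hS.converges.comp_tendsto φ
    have h2 := hasSum_evalAdd θ hx (magnusVal Λ σ)
    rw [evalHom_magnusVal hS.generates hΛ hθ hx, h φ] at h2
    have h3 := h2.map (Matrix.entryAddMonoidHom R ⟨0, by omega⟩ ⟨I.length, hn⟩)
      (continuous_id.matrix_elem _ _)
    have h4 : HasSum (fun K : {K : List A // K.length < n} =>
        Matrix.entryAddMonoidHom R ⟨0, by omega⟩ ⟨I.length, hn⟩
          (θ (magnusVal Λ σ K.1) • monomialMat (fun a => φ (ι a)) K.1))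
        (θ (magnusVal Λ σ I) * d ^ I.length) := by
      classical
      -- In the entry $(0,|I|)$ only a prefix of $I$ of length $|I|$ contributes, that is $K=I$.
      have hval : ∀ K : {K : List A // K.length < n},
          Matrix.entryAddMonoidHom R ⟨0, by omega⟩ ⟨I.length, hn⟩
            (θ (magnusVal Λ σ K.1) • monomialMat (fun a => φ (ι a)) K.1) =
          θ (magnusVal Λ σ K.1) * if K.1 = I then d ^ I.length else 0 := by
        intro K
        rw [funext hφ]
        change θ (magnusVal Λ σ K.1) * monomialMat (seqUnip n d I) K.1 _ _ = _
        rw [monomialMat_seqUnip]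
        by_cases hK : K.1 = I
        · rw [if_pos hK, if_pos (by simp [hK]), hK]
        · rw [if_neg hK, if_neg]
          rintro ⟨hl, hp⟩
          refine hK (List.IsPrefix.eq_of_length (by simpa using hp) (by simpa using hl.symm))
      convert hasSum_single (⟨I, hn⟩ : {K : List A // K.length < n}) ?_ using 1
      · rw [hval, if_pos rfl]
      · intro K hK
        rw [hval, if_neg fun h => hK (Subtype.ext h), mul_zero]
    have h5 := h3.unique h4
    -- Because $|I|\ge 1$, this entry of the identity matrix is off the diagonal.
    have h6 : θ (magnusVal Λ σ I) * d ^ I.length = 0 := by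
      rw [← h5]
      refine Matrix.one_apply_ne fun h => ?_
      have := congrArg Fin.val h
      simp only at this
      omega
    rw [Submodule.mem_annihilator]
    intro r hr
    obtain ⟨s, rfl⟩ := Ideal.mem_span_singleton'.1 hr
    rw [smul_eq_mul, mul_left_comm, h6, mul_zero]
  · intro h φ
    have hx := hS.converges.comp_tendsto φ
    have h2 := hasSum_evalAdd θ hx (magnusVal Λ σ)
    rw [evalHom_magnusVal hS.generates hΛ hθ hx] at h2
    refine Subtype.ext (Units.ext ?_)
    rcases Nat.eq_zero_or_pos n with rfl | hn
    · exact Subsingleton.elim _ _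
    refine h2.unique ?_
    convert hasSum_single (⟨[], hn⟩ : {K : List A // K.length < n}) ?_ using 1
    · change (1 : Matrix (Fin n) (Fin n) R) = _
      rw [h.1, map_one, one_smul]
      rfl
    · rintro ⟨K, hK⟩ hne
      refine smul_monomialMat_eq_zero (h.2 K ?_ hK)
      rcases K with _ | ⟨a, K⟩
      · exact absurd rfl hne
      · simp

end MagnusHom

/-! ## The lower central series -/

/-- The three subgroups lemma, applied in the quotient by the right-hand side. -/
theorem Subgroup.commutator_commutator_le_sup {G : Type*} [Group G] (H₁ H₂ H₃ : Subgroup G)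
    [H₁.Normal] [H₂.Normal] [H₃.Normal] :
    ⁅⁅H₁, H₂⁆, H₃⁆ ≤ ⁅⁅H₂, H₃⁆, H₁⁆ ⊔ ⁅⁅H₃, H₁⁆, H₂⁆ := by
  set N := ⁅⁅H₂, H₃⁆, H₁⁆ ⊔ ⁅⁅H₃, H₁⁆, H₂⁆ with hN
  have hker : ∀ K : Subgroup G, K.map (QuotientGroup.mk' N) = ⊥ ↔ K ≤ N := fun K => by
    rw [Subgroup.map_eq_bot_iff, QuotientGroup.ker_mk']
  rw [← hker, Subgroup.map_commutator, Subgroup.map_commutator]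
  apply Subgroup.commutator_commutator_eq_bot_of_rotate
  · rw [← Subgroup.map_commutator, ← Subgroup.map_commutator, hker]
    exact le_sup_left
  · rw [← Subgroup.map_commutator, ← Subgroup.map_commutator, hker]
    exact le_sup_right

/-- Induction on $j$ by the three subgroups lemma. The extra $1$ comes from the numbering of the
series, which starts at $0$. -/
theorem Subgroup.commutator_lowerCentralSeries_le {G : Type*} [Group G] (i j : ℕ) :
    ⁅(⊤ : Subgroup G).lowerCentralSeries i, (⊤ : Subgroup G).lowerCentralSeries j⁆ ≤
      (⊤ : Subgroup G).lowerCentralSeries (i + j + 1) := by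
  induction j generalizing i with
  | zero => exact le_rfl
  | succ j ih =>
    rw [Subgroup.commutator_comm, Subgroup.lowerCentralSeries_succ]
    refine (Subgroup.commutator_commutator_le_sup _ _ _).trans (sup_le ?_ ?_)
    · rw [Subgroup.commutator_comm ⊤, ← Subgroup.lowerCentralSeries_succ]
      refine (ih (i + 1)).trans_eq ?_
      congr 1
      omega
    · refine (Subgroup.commutator_mono (ih i) le_rfl).trans_eq ?_
      rw [← Subgroup.lowerCentralSeries_succ]
      congr 1

/-- The lower central series as a filtration, indexed so that the first two terms are the whole
group. -/
def lowerCentralFiltration (G : Type*) [Group G] : CommFiltration G where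
  toFun i := (⊤ : Subgroup G).lowerCentralSeries (i - 1)
  anti _ _ h := Subgroup.lowerCentralSeries_antitone _ (Nat.sub_le_sub_right h 1)
  comm_mem {i j a b} ha hb := by
    have h := Subgroup.commutator_lowerCentralSeries_le (G := G) _ _
      (Subgroup.commutator_mem_commutator ha hb)
    exact Subgroup.lowerCentralSeries_antitone _
      (show i + j - 1 ≤ i - 1 + (j - 1) + 1 by omega) h

section ClosedLowerCentral

variable {S : Type*} [Group S] [TopologicalSpace S] [IsTopologicalGroup S]

theorem isClosed_closedLowerCentral (n : ℕ) : IsClosed (closedLowerCentral S n : Set S) := by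
  rcases n with _ | _ | n
  · exact isClosed_univ
  · exact isClosed_univ
  · exact Subgroup.isClosed_topologicalClosure _

instance normal_closedLowerCentral : ∀ n : ℕ, (closedLowerCentral S n).Normal
  | 0 => inferInstanceAs (⊤ : Subgroup S).Normal
  | 1 => inferInstanceAs (⊤ : Subgroup S).Normal
  | n + 2 =>
    have : (closedLowerCentral S (n + 1)).Normal := normal_closedLowerCentral (n + 1)
    Subgroup.is_normal_topologicalClosure _

theorem lowerCentralSeries_le_closedLowerCentral (n : ℕ) :
    (⊤ : Subgroup S).lowerCentralSeries n ≤ closedLowerCentral S (n + 1) := by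
  induction n with
  | zero => exact le_top
  | succ n ih =>
    rw [Subgroup.lowerCentralSeries_succ, Subgroup.commutator_comm]
    exact (Subgroup.commutator_mono le_rfl ih).trans (Subgroup.le_topologicalClosure _)

theorem lowerCentralSeries_map_le {G H : Type*} [Group G] [Group H] {f : G →* H}
    (hf : Function.Surjective f) (n : ℕ) : (⊤ : Subgroup H).lowerCentralSeries n ≤
      ((⊤ : Subgroup G).lowerCentralSeries n).map f := by
  induction n with
  | zero => simp [← MonoidHom.range_eq_map, MonoidHom.range_eq_top.2 hf]
  | succ n ih =>
    rw [Subgroup.lowerCentralSeries_succ, Subgroup.lowerCentralSeries_succ, Subgroup.map_commutator]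
    refine Subgroup.commutator_mono ih ?_
    simp [← MonoidHom.range_eq_map, MonoidHom.range_eq_top.2 hf]

end ClosedLowerCentral

/-! ## Magnus coefficients and triviality in weights -/

section Discrete

variable {A : Type*}

/-- The Magnus homomorphism of the free group. -/
noncomputable def freeMagnus (A : Type*) : FreeGroup A →* (MagnusAlgebra ℤ A)ˣ :=
  FreeGroup.lift fun a =>
    ((MagnusAlgebra.toV (1 + MagnusAlgebra.X a) (by simp [MagnusAlgebra.add_apply]) :
      MagnusAlgebra.V ℤ A) : (MagnusAlgebra ℤ A)ˣ)

theorem freeMagnus_of (a : A) :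
    (freeMagnus A (FreeGroup.of a) : MagnusAlgebra ℤ A) = 1 + MagnusAlgebra.X a := by
  rw [freeMagnus, FreeGroup.lift_apply_of]
  rfl

theorem freeMagnus_nil (f : FreeGroup A) : (freeMagnus A f : MagnusAlgebra ℤ A) [] = 1 := by
  have h : (freeMagnus A).range ≤ MagnusAlgebra.V ℤ A := by
    rw [freeMagnus, FreeGroup.range_lift_eq_closure, Subgroup.closure_le]
    rintro _ ⟨a, rfl⟩
    exact Subtype.property _
  exact MagnusAlgebra.V_nil ⟨_, h ⟨f, rfl⟩⟩

/-! ### Truncated evaluation in filtered rings -/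

variable {B : Type*} [Ring B] (F : MulFiltration B) {w : A → ℕ} {n : ℕ}
  (hfin : {I : List A | (I.map w).sum < n}.Finite) {u : A → Bˣ}

/-- The product of the elements `u_a - 1` along a sequence. -/
def prodSubOne (u : A → Bˣ) (I : List A) : B := (I.map fun a => (u a : B) - 1).prod

theorem prodSubOne_append (I J : List A) :
    prodSubOne u (I ++ J) = prodSubOne u I * prodSubOne u J := by
  simp [prodSubOne]

variable (u) in
/-- The truncated evaluation of an integral power series. -/
noncomputable def truncEval (c : MagnusAlgebra ℤ A) : B :=
  ∑ I ∈ hfin.toFinset, c I • prodSubOne u I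

theorem truncEval_add (c c' : MagnusAlgebra ℤ A) :
    truncEval hfin u (c + c') = truncEval hfin u c + truncEval hfin u c' := by
  simp [truncEval, MagnusAlgebra.add_apply, add_smul, Finset.sum_add_distrib]

variable (hu : ∀ a, u a ∈ F.oneUnits (w a))

include hu

theorem prodSubOne_mem (I : List A) : prodSubOne u I ∈ F (I.map w).sum := by
  induction I with
  | nil => exact F.one_mem
  | cons a I ih => exact F.mul_mem (hu a).1 ih

theorem truncEval_mem (c : MagnusAlgebra ℤ A) : truncEval hfin u c ∈ F 0 :=
  sum_mem fun I _ => zsmul_mem (F.anti (Nat.zero_le _) (prodSubOne_mem F hu I)) _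

theorem truncEval_monomial_sub_mem (I : List A) :
    truncEval hfin u (MagnusAlgebra.monomial I) - prodSubOne u I ∈ F n := by
  classical
  by_cases hI : I ∈ hfin.toFinset
  · rw [truncEval, Finset.sum_eq_single I, MagnusAlgebra.monomial_apply, if_pos rfl, one_smul,
      sub_self]
    · exact zero_mem _
    · intro J _ hJ
      rw [MagnusAlgebra.monomial_apply, if_neg hJ, zero_smul]
    · exact fun h => absurd hI h
  · rw [truncEval, Finset.sum_eq_zero, zero_sub]
    · refine neg_mem (F.anti ?_ (prodSubOne_mem F hu I))
      simpa using hI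
    · intro J hJ
      rw [MagnusAlgebra.monomial_apply, if_neg (by rintro rfl; exact hI hJ), zero_smul]

/-- Splittings of the words of weight below $n$ account for those pairs of such words whose
concatenation is still short. All other pairs contribute products of weight at least $n$. -/
theorem truncEval_mul_sub_mem (c c' : MagnusAlgebra ℤ A) :
    truncEval hfin u (c * c') - truncEval hfin u c * truncEval hfin u c' ∈ F n := by
  classical
  have h1 : truncEval hfin u (c * c') =
      ∑ p ∈ (hfin.toFinset ×ˢ hfin.toFinset).filter (fun p => p.1 ++ p.2 ∈ hfin.toFinset),
        (c p.1 * c' p.2) • prodSubOne u (p.1 ++ p.2) := by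
    simp only [truncEval, MagnusAlgebra.mul_apply, Finset.sum_smul]
    rw [Finset.sum_sigma']
    refine Finset.sum_bij' (fun x _ => (x.1.take x.2, x.1.drop x.2))
      (fun p _ => ⟨p.1 ++ p.2, p.1.length⟩) ?_ ?_ ?_ ?_ ?_
    · rintro ⟨I, i⟩ h
      have h2 := congrArg List.sum (congrArg (List.map w) (List.take_append_drop i I))
      rw [List.map_append, List.sum_append] at h2
      simp only [Finset.mem_sigma, Set.Finite.mem_toFinset, Set.mem_ofPred_eq] at h
      simp only [Finset.mem_filter, Finset.mem_product, Set.Finite.mem_toFinset,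
        Set.mem_ofPred_eq, List.take_append_drop]
      exact ⟨⟨by omega, by omega⟩, h.1⟩
    · rintro ⟨J, K⟩ h
      simp only [Finset.mem_filter] at h
      simp only [Finset.mem_sigma, Finset.mem_range, List.length_append]
      exact ⟨h.2, by omega⟩
    · rintro ⟨I, i⟩ h
      simp only [Finset.mem_sigma, Finset.mem_range] at h
      simp only [List.take_append_drop, List.length_take, Sigma.mk.injEq, heq_eq_eq, true_and]
      omega
    · rintro ⟨J, K⟩ h
      simp
    · rintro ⟨I, i⟩ h
      simp
  have h2 : truncEval hfin u c * truncEval hfin u c' =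
      ∑ p ∈ hfin.toFinset ×ˢ hfin.toFinset,
        (c p.1 * c' p.2) • prodSubOne u (p.1 ++ p.2) := by
    rw [truncEval, truncEval, Finset.sum_mul_sum, Finset.sum_product]
    refine Finset.sum_congr rfl fun I _ => Finset.sum_congr rfl fun J _ => ?_
    rw [smul_mul_smul_comm, prodSubOne_append]
  rw [h1, h2, ← Finset.sum_filter_add_sum_filter_not (hfin.toFinset ×ˢ hfin.toFinset)
    (fun p : List A × List A => p.1 ++ p.2 ∈ hfin.toFinset)
    (fun p => (c p.1 * c' p.2) • prodSubOne u (p.1 ++ p.2)), sub_add_cancel_left]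
  refine neg_mem (sum_mem fun p hp => zsmul_mem (F.anti ?_ (prodSubOne_mem F hu _)) _)
  simpa using (Finset.mem_filter.1 hp).2

theorem lift_mem_oneUnits_zero (f : FreeGroup A) : FreeGroup.lift u f ∈ F.oneUnits 0 := by
  have h : (FreeGroup.lift u).range ≤ F.oneUnits 0 := by
    rw [FreeGroup.range_lift_eq_closure, Subgroup.closure_le]
    rintro _ ⟨a, rfl⟩
    exact F.oneUnits_anti (Nat.zero_le _) (hu a)
  exact h ⟨f, rfl⟩

/-- Truncated evaluation is multiplicative modulo the $n$-th step and correct on generators;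
induction over words then gives all of the free group. -/
theorem truncEval_freeMagnus_sub_mem (f : FreeGroup A) :
    truncEval hfin u (freeMagnus A f) - (FreeGroup.lift u f : Bˣ) ∈ F n := by
  have hone : truncEval hfin u 1 - 1 ∈ F n := truncEval_monomial_sub_mem F hfin hu []
  have hmem := fun f => F.mem_of_sub_one (lift_mem_oneUnits_zero F hu f).1
  induction f using FreeGroup.induction_on with
  | C1 => simpa using hone
  | of a =>
    have h2 := truncEval_monomial_sub_mem F hfin hu [a]
    rw [MagnusAlgebra.monomial_singleton] at h2
    rw [FreeGroup.lift_apply_of, freeMagnus_of, truncEval_add]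
    have := add_mem hone h2
    convert this using 1
    simp only [prodSubOne, List.map_cons, List.map_nil, List.prod_cons, List.prod_nil, mul_one]
    abel
  | inv_of a ih =>
    set x := FreeGroup.of a
    have h1 := truncEval_mul_sub_mem F hfin hu (freeMagnus A x) (freeMagnus A x⁻¹)
    rw [← Units.val_mul, ← map_mul, mul_inv_cancel, map_one, Units.val_one] at h1
    -- The truncated value at $x^{-1}$ inverts that of $x$ modulo the $n$-th step; multiplying by
    -- the true inverse identifies it.
    have h2 : ((FreeGroup.lift u x : Bˣ) : B) * truncEval hfin u (freeMagnus A x⁻¹) - 1 ∈ F n := by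
      have h3 := F.mul_mem_right ih (truncEval_mem F hfin hu (freeMagnus A x⁻¹))
      convert sub_mem hone (add_mem h1 h3) using 1
      noncomm_ring
    convert F.mul_mem_left (hmem x⁻¹) h2 using 1
    rw [mul_sub, ← mul_assoc, ← Units.val_mul, ← map_mul]
    simp
  | mul x y hx hy =>
    have h1 := truncEval_mul_sub_mem F hfin hu (freeMagnus A x) (freeMagnus A y)
    have h2 := F.mul_mem_right hx (truncEval_mem F hfin hu (freeMagnus A y))
    have h3 := F.mul_mem_left (hmem x) hy
    convert add_mem (add_mem h1 h2) h3 using 1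
    rw [map_mul, map_mul, Units.val_mul, Units.val_mul]
    noncomm_ring

omit hu in
include hfin in
/-- A word whose Magnus coefficients in small weights are divisible by `m` is `m`-trivial. -/
theorem isTrivialInWeights_of_dvd (hn : 0 < n) {m : ℕ} {f : FreeGroup A}
    (h : ∀ I : List A, I ≠ [] → (I.map w).sum < n →
      (m : ℤ) ∣ (freeMagnus A f : MagnusAlgebra ℤ A) I) : IsTrivialInWeights m n w f := by
  intro B _ F u hm hu
  have h1 := truncEval_freeMagnus_sub_mem F hfin hu f
  have h2 : truncEval hfin u (freeMagnus A f) = 1 := by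
    rw [truncEval, Finset.sum_eq_single []]
    · rw [freeMagnus_nil, one_smul]
      rfl
    · intro I hI hne
      obtain ⟨q, hq⟩ := h I hne (by simpa using hI)
      rw [hq, zsmul_eq_mul]
      simp [hm]
    · intro h
      simp at h
      omega
  rw [h2] at h1
  simpa using neg_mem h1

end Discrete

/-! ## Divisibility by `Π`-numbers in `Ẑ_C` -/

/-- At primes not dividing $m$ the condition is void because $m$ is a unit there, so finitely many
open conditions remain. -/
theorem isOpen_setOf_natCast_dvd {P : Set Nat.Primes} {m : ℕ} (hm : m ≠ 0) :
    IsOpen {z : ZHatPi P | ∀ p : P, (m : ℤ_[((p : Nat.Primes) : ℕ)]) ∣ z p} := by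
  have hfin : {p : P | ((p : Nat.Primes) : ℕ) ∣ m}.Finite := by
    refine Set.Finite.of_finite_image (f := fun p : P => ((p : Nat.Primes) : ℕ)) ?_
      (fun p _ q _ h => Subtype.ext (Subtype.ext h))
    refine (m.divisors : Set ℕ).toFinite.subset ?_
    rintro _ ⟨p, hp, rfl⟩
    simpa using ⟨hp, hm⟩
  have : {z : ZHatPi P | ∀ p : P, (m : ℤ_[((p : Nat.Primes) : ℕ)]) ∣ z p} =
      ⋂ p ∈ {p : P | ((p : Nat.Primes) : ℕ) ∣ m},
        {z : ZHatPi P | (m : ℤ_[((p : Nat.Primes) : ℕ)]) ∣ z p} := by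
    ext z
    simp only [Set.mem_ofPred_eq, Set.mem_iInter]
    refine ⟨fun h p _ => h p, fun h p => ?_⟩
    by_cases hp : ((p : Nat.Primes) : ℕ) ∣ m
    · exact h p hp
    · refine IsUnit.dvd ?_
      rw [PadicInt.isUnit_iff, PadicInt.norm_natCast_eq_one_iff]
      exact (Nat.Prime.coprime_iff_not_dvd p.1.2).2 hp
  rw [this]
  refine hfin.isOpen_biInter fun p _ => ?_
  have hopen : IsOpen ((Ideal.span {(m : ℤ_[((p : Nat.Primes) : ℕ)])} :
      Ideal ℤ_[((p : Nat.Primes) : ℕ)]) : Set ℤ_[((p : Nat.Primes) : ℕ)]) := by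
    rw [IsDiscreteValuationRing.isOpen_iff]
    simpa using hm
  have hc : Continuous fun z : ZHatPi P => z p := continuous_apply p
  convert hopen.preimage hc using 1
  ext z
  simp [Ideal.mem_span_singleton]

/-- All prime powers dividing $m$ belong to primes of $\Pi$, and divisibility of an integer by $p^k$
can be tested in $\mathbb Z_p$. -/
theorem IsPiNumber.intCast_dvd {P : Set Nat.Primes} {m : ℕ} (hm : IsPiNumber P m) {e : ℤ}
    (h : ∀ p : P, (m : ℤ_[((p : Nat.Primes) : ℕ)]) ∣ (e : ℤ_[((p : Nat.Primes) : ℕ)])) :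
    (m : ℤ) ∣ e := by
  rw [Int.natCast_dvd, Nat.dvd_iff_prime_pow_dvd_dvd]
  intro p k hp hk
  rcases Nat.eq_zero_or_pos k with rfl | hk0
  · simp
  have hpP := hm.2 ⟨p, hp⟩ ((dvd_pow_self p hk0.ne').trans hk)
  have h1 := h ⟨⟨p, hp⟩, hpP⟩
  have : Fact p.Prime := ⟨hp⟩
  rw [← Int.natCast_dvd, Nat.cast_pow, ← PadicInt.pow_p_dvd_int_iff]
  refine dvd_trans ?_ h1
  exact_mod_cast Nat.cast_dvd_cast (α := ℤ_[p]) hk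

/-! ## The closed lower central series of a free pro-`Π` group -/

section LowerCentral

variable {P : Set Nat.Primes} {A : Type*} {S : Type*} [Group S] [TopologicalSpace S]
  [IsTopologicalGroup S] {ι : A → S} {Λ : S →ₜ* MagnusAlgebra.V (ZHatPi P) A}

omit [IsTopologicalGroup S] in
theorem magnusVal_lift (hΛ : ∀ a, magnusVal Λ (ι a) = 1 + MagnusAlgebra.X a) (f : FreeGroup A) :
    magnusVal Λ (FreeGroup.lift ι f) =
      MagnusAlgebra.mapCoeff A (Int.castRingHom (ZHatPi P)) (freeMagnus A f) := by
  have : (magnusVal Λ).toHomUnits.comp (FreeGroup.lift ι) =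
      (Units.map (MagnusAlgebra.mapCoeff A (Int.castRingHom (ZHatPi P)) :
        MagnusAlgebra ℤ A →* MagnusAlgebra (ZHatPi P) A)).comp (freeMagnus A) := by
    ext1 a
    refine Units.ext ?_
    change magnusVal Λ (FreeGroup.lift ι (FreeGroup.of a)) =
      MagnusAlgebra.mapCoeff A (Int.castRingHom (ZHatPi P))
        (freeMagnus A (FreeGroup.of a) : MagnusAlgebra ℤ A)
    rw [FreeGroup.lift_apply_of, hΛ, freeMagnus_of, map_add, map_one, MagnusAlgebra.mapCoeff_X]
  exact congrArg Units.val (DFunLike.congr_fun this f)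

/-- The hard inclusion. A closed subgroup is the intersection of the open subgroups above it, which
reduces the claim to finite nilpotent quotients, where the elimination theorem applies to an
approximating word. -/
theorem mem_closedLowerCentral_of_coeff (hP : IsProPi P S) (hι : ConvergesToOne ι)
    (hgen : (Subgroup.closure (Set.range ι)).topologicalClosure = ⊤)
    (hΛ : ∀ a, magnusVal Λ (ι a) = 1 + MagnusAlgebra.X a) {n : ℕ} (hn : 1 ≤ n) {σ : S}
    (hσ : ∀ I : List A, 1 ≤ I.length → I.length < n → magnusVal Λ σ I = 0) :
    σ ∈ closedLowerCentral S n := by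
  classical
  have := hP.compact
  have := hP.totallyDisconnected
  have hinf := ProfiniteGrp.closedSubgroup_eq_sInf_open
    (⟨closedLowerCentral S n, isClosed_closedLowerCentral n⟩ : ClosedSubgroup S)
  change closedLowerCentral S n = _ at hinf
  rw [hinf, Subgroup.mem_sInf]
  rintro N ⟨hN, hle⟩
  have hle : closedLowerCentral S n ≤ N := hle
  -- Normality of $S^{(n)}$ allows $N$ to be replaced by its normal core, which is still open.
  have hle' : closedLowerCentral S n ≤ N.normalCore :=
    Subgroup.normal_le_normalCore.2 hle
  have : N.FiniteIndex := @Subgroup.finiteIndex_of_finite_quotient _ _ _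
    (N.quotient_finite_of_isOpen hN)
  have hK : IsOpen (N.normalCore : Set S) := Subgroup.isOpen_of_isClosed_of_finiteIndex _
    (N.normalCore_isClosed (Subgroup.isClosed_of_isOpen N hN))
  refine N.normalCore_le ?_
  have hKn : N.normalCore.Normal := inferInstance
  generalize N.normalCore = K at hle' hK hKn
  obtain ⟨hfinite, hpi⟩ := hP.quotient K hK
  set m := Nat.card (S ⧸ K) with hm
  have hmP : IsPiNumber P m := ⟨Nat.card_pos.ne', hpi⟩
  -- Weight $n$ is harmless for generators that die in $S/K$. As $\iota$ converges to $1$, only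
  -- finitely many words then have weight below $n$.
  let w : A → ℕ := fun a => if ι a ∈ K then n else 1
  have hw1 : ∀ a, 1 ≤ w a := fun a => by
    simp only [w]
    split_ifs
    · exact hn
    · exact le_rfl
  have hwfin : {a | w a < n}.Finite := (hι K hKn hK).subset fun a ha haK => by
    have ha : w a < n := ha
    simp only [w, if_pos haK, lt_irrefl] at ha
  have hlen : ∀ I : List A, I.length ≤ (I.map w).sum := fun I => by
    simpa using List.length_le_sum_of_one_le (I.map w) (by simpa using fun a _ => hw1 a)
  have hfin : {I : List A | (I.map w).sum < n}.Finite := by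
    refine (finite_lists_of_finite hwfin n).subset fun I (hI : (I.map w).sum < n) =>
      ⟨(hlen I).trans_lt hI, fun a ha => ?_⟩
    exact (List.single_le_sum (fun x _ => Nat.zero_le x) _ (List.mem_map_of_mem ha)).trans_lt hI
  -- By density, an abstract word can agree with $\sigma$ modulo $K$ and have coefficients congruent
  -- modulo $m$ on the finitely many relevant words.
  obtain ⟨τ, ⟨hτσ, hτ⟩, f, rfl⟩ : ∃ τ : S, ((τ⁻¹ * σ ∈ K) ∧ ∀ I ∈ hfin.toFinset, ∀ p : P,
      (m : ℤ_[((p : Nat.Primes) : ℕ)]) ∣ (magnusVal Λ τ I - magnusVal Λ σ I : ZHatPi P) p) ∧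
        τ ∈ (FreeGroup.lift ι).range := by
    have hdense : Dense ((FreeGroup.lift ι).range : Set S) := by
      rw [FreeGroup.range_lift_eq_closure, dense_iff_closure_eq,
        ← Subgroup.topologicalClosure_coe, hgen, Subgroup.coe_top]
    have hev : ∀ᶠ τ in 𝓝 σ, (τ⁻¹ * σ ∈ K) ∧ ∀ I ∈ hfin.toFinset, ∀ p : P,
        (m : ℤ_[((p : Nat.Primes) : ℕ)]) ∣ (magnusVal Λ τ I - magnusVal Λ σ I : ZHatPi P) p := by
      refine Eventually.and ?_ ((eventually_all_finset _).2 fun I _ => ?_)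
      · have hc : Continuous fun τ : S => τ⁻¹ * σ := continuous_inv.mul continuous_const
        exact hc.continuousAt.eventually (hK.mem_nhds (by simp [K.one_mem]))
      · have hc : Continuous fun τ : S => (magnusVal Λ τ I - magnusVal Λ σ I : ZHatPi P) :=
          ((MagnusAlgebra.continuous_coeff I).comp (continuous_magnusVal Λ)).sub continuous_const
        exact hc.continuousAt.eventually ((isOpen_setOf_natCast_dvd hmP.1).mem_nhds
          (fun p => by simp))
    obtain ⟨τ, h1, h2⟩ := hdense.inter_nhds_nonempty hev
    exact ⟨τ, h2, h1⟩
  have htriv : IsTrivialInWeights m n w f := by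
    refine isTrivialInWeights_of_dvd hfin hn fun I hne hI => hmP.intCast_dvd fun p => ?_
    have h1 := hτ I (by simpa using hI) p
    rw [hσ I (List.length_pos_iff.2 hne) ((hlen I).trans_lt hI), sub_zero, magnusVal_lift hΛ] at h1
    exact h1
  -- The quotient has nilpotency class below $n$ because $K$ contains $S^{(n)}$.
  have hbot : lowerCentralFiltration (S ⧸ K) n = ⊥ := by
    rw [eq_bot_iff]
    refine (lowerCentralSeries_map_le (QuotientGroup.mk'_surjective K) (n - 1)).trans ?_
    rw [Subgroup.map_le_iff_le_comap, MonoidHom.comap_bot, QuotientGroup.ker_mk']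
    refine (lowerCentralSeries_le_closedLowerCentral (n - 1)).trans ?_
    rwa [Nat.sub_add_cancel hn]
  have hone := (lowerCentralFiltration (S ⧸ K)).lift_eq_one hbot (m := m)
    (fun g => pow_card_eq_one') w (fun a => (QuotientGroup.mk (ι a) : S ⧸ K)) hw1 hwfin
    (fun a => by
      by_cases ha : ι a ∈ K
      · rw [(QuotientGroup.eq_one_iff _).2 ha]
        exact one_mem _
      · have : w a = 1 := if_neg ha
        rw [this]
        exact Subgroup.mem_top _) htriv
  have hcomp : FreeGroup.lift (fun a => (QuotientGroup.mk (ι a) : S ⧸ K)) =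
      (QuotientGroup.mk' K).comp (FreeGroup.lift ι) := by
    ext a
    simp
  rw [hcomp] at hone
  have hmem : FreeGroup.lift ι f ∈ K := (QuotientGroup.eq_one_iff _).1 hone
  simpa using K.mul_mem hmem hτσ

/-! ### The degree filtration and the easy inclusion -/

/-- The filtration of the Magnus algebra by the degree. -/
def MagnusAlgebra.degreeFiltration (R A : Type*) [CommRing R] :
    MulFiltration (MagnusAlgebra R A) where
  toFun i :=
    { carrier := {f | ∀ I : List A, I.length < i → f I = 0}
      add_mem' := fun {f g} hf hg I hI => by
        rw [MagnusAlgebra.add_apply, hf I hI, hg I hI, add_zero]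
      zero_mem' := fun _ _ => rfl
      neg_mem' := fun {f} hf I hI => by rw [MagnusAlgebra.neg_apply, hf I hI, neg_zero] }
  one_mem := fun I hI => absurd hI (Nat.not_lt_zero _)
  mul_mem {i j f g} hf hg := fun I hI => by
    rw [MagnusAlgebra.mul_apply]
    refine Finset.sum_eq_zero fun k hk => ?_
    rw [Finset.mem_range] at hk
    rcases lt_or_ge k i with h | h
    · rw [hf _ (by rw [List.length_take]; omega), zero_mul]
    · rw [hg _ (by rw [List.length_drop]; omega), mul_zero]
  anti _ _ hij _ hf I hI := hf I (hI.trans_le hij)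

/-- From $ab-ba=(a-1)(b-1)-(b-1)(a-1)$ and $aba^{-1}b^{-1}-1=(ab-ba)(ba)^{-1}$. -/
theorem MulFiltration.commutator_oneUnits_le {B : Type*} [Ring B] (F : MulFiltration B)
    (i j : ℕ) : ⁅F.oneUnits i, F.oneUnits j⁆ ≤ F.oneUnits (i + j) := by
  have key : ∀ {i j : ℕ}, ∀ a ∈ F.oneUnits i, ∀ b ∈ F.oneUnits j,
      ((a * b * a⁻¹ * b⁻¹ : Bˣ) : B) - 1 ∈ F (i + j) := by
    intro i j a ha b hb
    have h1 : ((a * b : Bˣ) : B) - (b * a : Bˣ) ∈ F (i + j) := by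
      convert sub_mem (F.mul_mem ha.1 hb.1)
        (show _ ∈ F (i + j) from add_comm j i ▸ F.mul_mem hb.1 ha.1) using 1
      push_cast
      noncomm_ring
    have h2 : (((b * a)⁻¹ : Bˣ) : B) ∈ F 0 :=
      F.mem_of_sub_one ((F.oneUnits 0).mul_mem (F.oneUnits_anti (Nat.zero_le _) hb)
        (F.oneUnits_anti (Nat.zero_le _) ha)).2
    convert F.mul_mem_right h1 h2 using 1
    rw [sub_mul, ← Units.val_mul, ← Units.val_mul, mul_inv_cancel, Units.val_one]
    congr 2
    group
  rw [Subgroup.commutator_le]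
  intro a ha b hb
  refine ⟨key a ha b hb, ?_⟩
  rw [commutatorElement_inv, add_comm]
  exact key b hb a ha

/-- The units congruent to $1$ in degrees below $i$ form a central-type filtration. Their preimages
in $S$ are closed, hence contain the closed lower central subgroups. -/
theorem coeff_of_mem_closedLowerCentral {n : ℕ} (hn : 1 ≤ n) {σ : S}
    (hσ : σ ∈ closedLowerCentral S n) {I : List A} (h1 : 1 ≤ I.length) (hI : I.length < n) :
    magnusVal Λ σ I = 0 := by
  let F := MagnusAlgebra.degreeFiltration (ZHatPi P) A
  let L : S →* (MagnusAlgebra (ZHatPi P) A)ˣ :=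
    (MagnusAlgebra.V (ZHatPi P) A).subtype.comp (Λ : S →* _)
  have hcl : ∀ i, IsClosed ((F.oneUnits i).comap L : Set S) := by
    intro i
    have : ((F.oneUnits i).comap L : Set S) = ⋂ I : List A, ⋂ _ : I.length < i,
        ({σ | (magnusVal Λ σ - 1 : MagnusAlgebra (ZHatPi P) A) I = 0} ∩
          {σ | (magnusVal Λ σ⁻¹ - 1 : MagnusAlgebra (ZHatPi P) A) I = 0}) := by
      ext σ
      simp only [Set.mem_iInter, Set.mem_inter_iff]
      constructor
      · rintro ⟨h1, h2⟩ I hI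
        rw [← map_inv] at h2
        exact ⟨h1 I hI, h2 I hI⟩
      · intro h
        refine ⟨fun I hI => (h I hI).1, ?_⟩
        rw [← map_inv]
        exact fun I hI => (h I hI).2
    rw [this]
    refine isClosed_iInter fun I => isClosed_iInter fun _ => IsClosed.inter ?_ ?_
    · exact isClosed_eq ((MagnusAlgebra.continuous_coeff I).comp
        ((continuous_magnusVal Λ).sub continuous_const)) continuous_const
    · exact isClosed_eq ((MagnusAlgebra.continuous_coeff I).comp
        (((continuous_magnusVal Λ).comp continuous_inv).sub continuous_const)) continuous_const
  have htop : ∀ σ, L σ ∈ F.oneUnits 1 := by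
    have key : ∀ σ, (magnusVal Λ σ - 1 : MagnusAlgebra (ZHatPi P) A) ∈ F 1 := by
      intro σ I hI
      obtain rfl : I = [] := List.length_eq_zero_iff.1 (by omega)
      have h2 : magnusVal Λ σ [] = 1 := MagnusAlgebra.V_nil (Λ σ)
      rw [MagnusAlgebra.sub_apply, h2, MagnusAlgebra.one_nil, sub_self]
    intro σ
    refine ⟨key σ, ?_⟩
    rw [← map_inv]
    exact key σ⁻¹
  have hle : ∀ i, closedLowerCentral S (i + 1) ≤ (F.oneUnits (i + 1)).comap L := by
    intro i
    induction i with
    | zero => exact fun σ _ => htop σ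
    | succ i ih =>
      refine Subgroup.topologicalClosure_minimal _ ?_ (hcl _)
      rw [Subgroup.commutator_le]
      intro a _ b hb
      have := F.commutator_oneUnits_le _ _
        (Subgroup.commutator_mem_commutator (htop a) (ih hb))
      rw [Subgroup.mem_comap, map_commutatorElement]
      rwa [add_comm] at this
  obtain ⟨k, rfl⟩ : ∃ k, n = k + 1 := ⟨n - 1, by omega⟩
  have h2 := (hle k hσ).1 I hI
  have h3 : (1 : MagnusAlgebra (ZHatPi P) A) I = 0 :=
    MagnusAlgebra.const_of_ne 1 (List.length_pos_iff.1 h1)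
  rw [MagnusAlgebra.sub_apply, h3, sub_zero] at h2
  exact h2

end LowerCentral

theorem unip_eq_unipJ_one (n : ℕ) (R : Type*) [CommRing R] : unip n R = unipJ n (1 : R) := by
  ext u
  exact and_congr_left' mem_triRing_one_iff.symm

section Unipotent

variable {P : Set Nat.Primes} {A : Type u} {S : Type v} [Group S] [TopologicalSpace S]
  [IsTopologicalGroup S] {ι : A → S} {Λ : S →ₜ* MagnusAlgebra.V (ZHatPi P) A}

/-- For $d=1$ every $J_t$ is the whole ring and has zero annihilator. With $\theta$ injective,
$L_{\mathcal J}$ therefore says that the coefficients in degrees $1,\dots,n-1$ vanish. -/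
theorem closedLowerCentral_eq_kerIntCont (hS : IsFreeProPi.{max w y} P ι)
    (hΛ : ∀ a, magnusVal Λ (ι a) = 1 + MagnusAlgebra.X a) {R : Type w} [CommRing R]
    [TopologicalSpace R] [IsTopologicalRing R] [CompactSpace R] [T2Space R]
    [TotallyDisconnectedSpace R] {θ : ZHatPi P →+* R} (hθ : Continuous θ)
    (hinj : Function.Injective θ) {n : ℕ} (hn : 1 ≤ n) :
    closedLowerCentral S n = kerIntCont S (unip n R) := by
  rw [unip_eq_unipJ_one]
  ext σ
  rw [mem_kerIntCont_iff Λ hS hΛ hθ n 1]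
  have hann : ∀ t : ℕ, ∀ r : R, r ∈ (idealJ (1 : R) t).annihilator ↔ r = 0 := fun t r => by
    rw [idealJ, one_pow, Ideal.span_singleton_one]
    exact ⟨fun h => by simpa using Submodule.mem_annihilator.1 h 1 trivial, by rintro rfl; exact zero_mem _⟩
  constructor
  · intro hσ
    refine ⟨MagnusAlgebra.V_nil (Λ σ), fun I h1 hI => ?_⟩
    rw [hann, coeff_of_mem_closedLowerCentral hn hσ h1 hI, map_zero]
  · intro h
    refine mem_closedLowerCentral_of_coeff hS.isProPi hS.converges hS.generates hΛ hn
      fun I h1 hI => ?_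
    have := h.2 I h1 hI
    rwa [hann, map_eq_zero_iff θ hinj] at this

end Unipotent

/-! ## The main theorem -/

theorem mainTheorem5 (P : Set Nat.Primes)
    {A : Type u} {S : Type v} [Group S] [TopologicalSpace S] [IsTopologicalGroup S]
    (ι : A → S) (hS : IsFreeProPi.{max u v w} P ι) :
    -- the continuous Magnus homomorphism exists and is unique
    ∃ Λ : S →ₜ* MagnusAlgebra.V (ZHatPi P) A,
      (∀ a, (((Λ (ι a) : MagnusAlgebra.V (ZHatPi P) A) : (MagnusAlgebra (ZHatPi P) A)ˣ) :
        MagnusAlgebra (ZHatPi P) A) = 1 + MagnusAlgebra.X a) ∧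
      (∀ Λ' : S →ₜ* MagnusAlgebra.V (ZHatPi P) A,
        (∀ a, (((Λ' (ι a) : MagnusAlgebra.V (ZHatPi P) A) : (MagnusAlgebra (ZHatPi P) A)ˣ) :
          MagnusAlgebra (ZHatPi P) A) = 1 + MagnusAlgebra.X a) → Λ' = Λ) ∧
      ∀ n : ℕ, 1 ≤ n →
        (∀ (R : Type w) [CommRing R] [TopologicalSpace R] [IsTopologicalRing R] [CompactSpace R]
          [T2Space R] [TotallyDisconnectedSpace R], IsProPi P (Multiplicative R) →
          ∀ θ : ZHatPi P →+* R, Continuous θ → ∀ d : R,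
            IsProPi P (unipJ n d) ∧
            (∀ t < n, IsClosed ((idealJ d t).annihilator : Set R)) ∧
            IsClosed (magnusL A n θ d) ∧
            -- the lifting of continuous representations to the Magnus algebra
            (∀ φ : S →ₜ* unipJ n d,
              (∀ I : List A, monomialMat (fun a => φ (ι a)) I ∈ triMat n d I.length) ∧
              ∃ Φ : MagnusAlgebra (ZHatPi P) A →+* triRing n d, Continuous Φ ∧
                (∀ f : MagnusAlgebra (ZHatPi P) A,
                  HasSum (fun I : {I : List A // I.length < n} =>
                    θ (f I.1) • monomialMat (fun a => φ (ι a)) I.1)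
                    (Φ f : Matrix (Fin n) (Fin n) R)) ∧
                ((∀ c : ZHatPi P, (Φ (MagnusAlgebra.const c) : Matrix (Fin n) (Fin n) R) =
                    θ c • (1 : Matrix (Fin n) (Fin n) R)) ∧
                  ∀ σ : S, (Φ ((Λ σ : (MagnusAlgebra (ZHatPi P) A)ˣ) :
                    MagnusAlgebra (ZHatPi P) A) : Matrix (Fin n) (Fin n) R) =
                    ((φ σ : unipJ n d) : (Matrix (Fin n) (Fin n) R)ˣ)) ∧
                ∀ Ψ : MagnusAlgebra (ZHatPi P) A →+* triRing n d, Continuous Ψ →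
                  (∀ c : ZHatPi P, (Ψ (MagnusAlgebra.const c) : Matrix (Fin n) (Fin n) R) =
                    θ c • (1 : Matrix (Fin n) (Fin n) R)) →
                  (∀ σ : S, (Ψ ((Λ σ : (MagnusAlgebra (ZHatPi P) A)ˣ) :
                    MagnusAlgebra (ZHatPi P) A) : Matrix (Fin n) (Fin n) R) =
                    ((φ σ : unipJ n d) : (Matrix (Fin n) (Fin n) R)ˣ)) → Ψ = Φ) ∧
            -- the intersection theorem
            {σ : S | ((Λ σ : (MagnusAlgebra (ZHatPi P) A)ˣ) : MagnusAlgebra (ZHatPi P) A) ∈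
              magnusL A n θ d} = (kerIntCont S (unipJ n d) : Set S)) ∧
        -- the lower central filtration
        closedLowerCentral S n = kerIntCont S (unip n (ZHatPi P)) ∧
        ∀ p : Nat.Primes, P = {p} → closedLowerCentral S n = kerIntCont S (unip n ℤ_[(p : ℕ)]) := by
  classical
  let φ₀ : A → MagnusAlgebra.V (ZHatPi P) A := fun a =>
    MagnusAlgebra.toV (1 + MagnusAlgebra.X a) (by simp [MagnusAlgebra.add_apply])
  obtain ⟨Λ, hΛ, huniq⟩ := IsFreeProPi.existsUnique_lift.{u, v, u, max u v w} hS
    (MagnusAlgebra.isProPi_V P A) (φ := φ₀) (MagnusAlgebra.convergesToOne_of_X P fun a => rfl)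
  have hΛ' : ∀ a, magnusVal Λ (ι a) = 1 + MagnusAlgebra.X a := fun a =>
    congrArg (fun g : MagnusAlgebra.V (ZHatPi P) A =>
      ((g : (MagnusAlgebra (ZHatPi P) A)ˣ) : MagnusAlgebra (ZHatPi P) A)) (hΛ a)
  have := hS.isProPi.compact
  have := hS.isProPi.totallyDisconnected
  refine ⟨Λ, hΛ', fun Λ' h => huniq Λ' fun a => Subtype.ext (Units.ext (h a)), fun n hn =>
    ⟨?_, ?_, ?_⟩⟩
  · intro R _ _ _ _ _ _ _ θ hθ d
    refine ⟨isProPi_unipJ hθ n d, fun t _ => isClosed_annihilator _, isClosed_magnusL A n hθ d,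
      fun φ => ⟨monomialMat_mem _, ?_⟩, ?_⟩
    · have hx := hS.converges.comp_tendsto φ
      have hev := evalHom_magnusVal hS.generates hΛ' hθ hx
      refine ⟨evalHom hθ hx, continuous_evalHom hθ hx, hasSum_evalAdd θ hx,
        ⟨evalAdd_const hx, hev⟩, fun Ψ hΨ hc hΨΛ => ?_⟩
      refine MagnusAlgebra.ringHom_ext hΨ (continuous_evalHom hθ hx)
        (fun c => Subtype.ext ((hc c).trans (evalAdd_const hx c).symm)) fun a => ?_
      -- Compatibility with $\Lambda$ at $\iota(a)$ determines the value at $X_a$, which together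
      -- with the constants determines a continuous ring homomorphism.
      have h1 : Ψ (1 + MagnusAlgebra.X a) = evalHom hθ hx (1 + MagnusAlgebra.X a) := by
        rw [← hΛ']
        exact Subtype.ext ((hΨΛ (ι a)).trans (hev (ι a)).symm)
      rwa [map_add, map_add, map_one, map_one, add_right_inj] at h1
    · ext σ
      exact (mem_kerIntCont_iff.{u, v, w, max u v w} Λ hS hΛ' hθ n d σ).symm
  · exact closedLowerCentral_eq_kerIntCont.{u, v, 0, max u v w} hS hΛ'
      (θ := RingHom.id (ZHatPi P)) continuous_id Function.injective_id hn
  · rintro p rfl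
    -- For a single prime the product has one factor, so this projection is injective.
    let θ : ZHatPi {p} →+* ℤ_[(p : ℕ)] :=
      Pi.evalRingHom (fun q : ({p} : Set Nat.Primes) => ℤ_[((q : Nat.Primes) : ℕ)]) ⟨p, rfl⟩
    refine closedLowerCentral_eq_kerIntCont.{u, v, 0, max u v w} hS hΛ' (θ := θ)
      (continuous_apply (A := fun q : ({p} : Set Nat.Primes) => ℤ_[((q : Nat.Primes) : ℕ)])
        (⟨p, rfl⟩ : ({p} : Set Nat.Primes))) (fun a b h => ?_) hn
    funext ⟨q, hq⟩
    obtain rfl : q = p := hq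
    exact h
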